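/- Let $a\in C([0,1])\cap C^1((0,1])$ satisfy $a(0)=0$, $a(x)>0$ for $x\in(0,1]$, $\mu_a:=\sup_{0<x\le 1}\frac{x|a'(x)|}{a(x)}<2$ and $a\in C^{[\mu_a]}([0,1])$, where $[\cdot]$ is the integer part. Let $V^1_a(0,1)$ be the space of all $w\in L^2(0,1)$ that are locally absolutely continuous in $(0,1]$ and satisfy $\sqrt a\,w'\in L^2(0,1)$. Let $H^1_a(0,1)$ be the space of all $w\in V^1_a(0,1)$ with $w(1)=0$ and, if $\mu_a<1$, also $w(0)=0$, and let $H^2_a(0,1)=\{w\in H^1_a(0,1): aw'\in H^1(0,1)\}$. On $\mathcal H_0=H^1_a(0,1)\times L^2(0,1)$, with norm $\|(w,v)\|^2=\int_0^1(v^2+a\,(w')^2)\,dx$, consider the operator $A(w,v)=(v,(aw')')$ with domain $D(A)=H^2_a(0,1)\times H^1_a(0,1)$. A mild solution $u$ of the degenerate wave equation $$u_{tt}-(a(x)u_x)_x=0\quad\text{in }(0,\infty)\times(0,1)$$ (with $u(t,1)=0$, and with $u(t,0)=0$ if $\mu_a<1$, $\lim_{x\downarrow0}a(x)u_x(t,x)=0$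 if $\mu_a\ge1$) is the first component of a mild solution $U=(u,u_t)\in C([0,\infty);\mathcal H_0)$ of $U'=AU$, that is, $\int_0^tU(s)\,ds\in D(A)$ and $U(t)=U(0)+A\int_0^tU(s)\,ds$ for all $t\ge0$ (equivalently, $U(t)=e^{tA}U(0)$). It is classical if $U(t)\in D(A)$ for all $t\ge 0$ and $U\in C^1([0,\infty);\mathcal H_0)$ with $U'=AU$. Its energy is $E_u(t)=\frac12\int_0^1\big(u_t(t,x)^2+a(x)u_x(t,x)^2\big)\,dx$. The normal derivative $u_x(\cdot,1)$ of a mild solution is the limit in $L^2(0,T)$, for every $T\ge 0$, of the functions $u^n_x(\cdot,1)$ for any sequence of classical solutions $u^n$ whose initial data converge in $\mathcal H_0$ to those of $u$. Then, for every mild solution $u$, the normal derivative $u_x(\cdot,1)$ is well defined in this sense (approximating sequences exist, and the limits exist and do not depend on the sequence), and for every $T\ge0$ one has $u_x(\cdot,1)\in L^2(0,T)$, $$a(1)\int_0^Tu_x(t,1)^2\,dt\le\Big(6T+\frac{4}{\min\{1,a(1)\}}\Big)E_u(0),$$ and $$a(1)\int_0^Tu_x(t,1)^2\,dt=\int_0^T\!\!\int_0^1\Big\{u_t(t,x)^2+\big(a(x)-x\,a'(x)\big)u_x(t,x)^2\Big\}\,dx\,dt+2\Big[\int_0^1x\,u_x(t,x)\,u_t(t,x)\,dx\Big]_{t=0}^{t=T}.$$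 -/

import Mathlib

open MeasureTheory Set Filter Topology

noncomputable section

namespace DegenerateWave

/-- Lebesgue measure on the interval `(0,1)`. -/
abbrev unitMeasure : Measure ℝ := volume.restrict (Ioo (0 : ℝ) 1)

/-- The Hilbert space `L²(0,1)`. -/
abbrev L2 : Type := Lp ℝ 2 unitMeasure

open scoped Classical in
/-- The class in `L²(0,1)` of a function on the real line whose restriction to `(0,1)` is square
integrable. (The value `0` for other functions is never used: membership in `L²` is required
separately wherever this map is applied.) -/
def toL2 (f : ℝ → ℝ) : L2 := if hf : MemLp f 2 unitMeasure then hf.toLp f else 0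

/-- The derivative of the coefficient, as a function on `[0,1]` (one-sided at `1`). -/
def coeffDeriv (a : ℝ → ℝ) (x : ℝ) : ℝ := derivWithin a (Icc 0 1) x

/-- The degeneracy parameter `μ_a = sup_{0 < x ≤ 1} x |a'(x)| / a(x)`. -/
def mu (a : ℝ → ℝ) : ℝ := sSup ((fun x => x * |coeffDeriv a x| / a x) '' Ioc 0 1)

/-- The standing assumptions on the coefficient `a`: it lies in `C([0,1]) ∩ C¹((0,1])`, is positive
on `(0,1]`, vanishes at `0`, satisfies `μ_a < 2` (with a finite supremum), and lies in
`C^[μ_a]([0,1])`, where `[·]` is the integer part. -/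
structure IsCoefficient (a : ℝ → ℝ) : Prop where
  continuousOn : ContinuousOn a (Icc 0 1)
  contDiffOn : ContDiffOn ℝ 1 a (Ioc 0 1)
  pos : ∀ x ∈ Ioc (0 : ℝ) 1, 0 < a x
  zero : a 0 = 0
  bddAbove : BddAbove ((fun x => x * |coeffDeriv a x| / a x) '' Ioc 0 1)
  mu_lt_two : mu a < 2
  contDiffOn_floor : ContDiffOn ℝ (⌊mu a⌋₊ : ℕ) a (Icc 0 1)

/-- The function `√a w'`. -/
def weightedDeriv (a w : ℝ → ℝ) (x : ℝ) : ℝ := √(a x) * deriv w x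

/-- The function `(a w')'`. -/
def degenOp (a w : ℝ → ℝ) (x : ℝ) : ℝ := deriv (fun y => a y * deriv w y) x

/-- The space `V¹_a(0,1)`: functions in `L²(0,1)` that are locally absolutely continuous in `(0,1]`
and satisfy `√a w' ∈ L²(0,1)`. -/
structure MemV1 (a w : ℝ → ℝ) : Prop where
  memLp : MemLp w 2 unitMeasure
  locallyAC : ∀ ε ∈ Ioo (0 : ℝ) 1, AbsolutelyContinuousOnInterval w ε 1
  memLp_weightedDeriv : MemLp (weightedDeriv a w) 2 unitMeasure

/-- The space `H¹_a(0,1)`: functions `w ∈ V¹_a(0,1)` with `w(1) = 0` and, in the weakly degenerate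
case `μ_a < 1`, also `w(0) = 0` (as the limit of `w` at `0`). -/
structure MemH1 (a w : ℝ → ℝ) : Prop extends MemV1 a w where
  at_one : w 1 = 0
  at_zero : mu a < 1 → Tendsto w (𝓝[>] 0) (𝓝 0)

/-- The space `V²_a(0,1)`: functions `w ∈ V¹_a(0,1)` such that `a w' ∈ H¹(0,1)`, that is, `a w'`
agrees almost everywhere with an absolutely continuous function `p` on `[0,1]` with
`p' ∈ L²(0,1)`. -/
structure MemV2 (a w : ℝ → ℝ) : Prop extends MemV1 a w where
  flux : ∃ p : ℝ → ℝ, AbsolutelyContinuousOnInterval p 0 1 ∧ MemLp (deriv p) 2 unitMeasure ∧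
    (fun x => a x * deriv w x) =ᵐ[unitMeasure] p

/-- The space `H²_a(0,1) = V²_a(0,1) ∩ H¹_a(0,1)`. -/
def MemH2 (a w : ℝ → ℝ) : Prop := MemV2 a w ∧ MemH1 a w

/-- The graph of the wave operator `A(u,v) = (v, (a u')')` with domain
`D(A) = H²_a(0,1) × H¹_a(0,1)`: `(u,v) ∈ D(A)` and `A(u,v) = (f,g)`. -/
structure WaveOp (a u v f g : ℝ → ℝ) : Prop where
  mem_left : MemH2 a u
  mem_right : MemH1 a v
  eq_left : f =ᵐ[unitMeasure] v
  eq_right : g =ᵐ[unitMeasure] degenOp a u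

/-- `(u, ut)` is a mild solution of the Cauchy problem `U' = A U`, `t ≥ 0`, in the energy space
`H¹_a(0,1) × L²(0,1)`: it is a continuous curve in the energy space, and for all `t ≥ 0` one has
`∫₀ᵗ U(s) ds ∈ D(A)` and `U(t) = U(0) + A ∫₀ᵗ U(s) ds`. Here `u t` and `ut t` are the functions
`u(t,·)` and `u_t(t,·)`; the functions `w` and `z` below represent the components
`∫₀ᵗ u(s) ds` and `∫₀ᵗ u_t(s) ds` (Bochner integrals) of `∫₀ᵗ U(s) ds`. -/
structure IsMildSolution (a : ℝ → ℝ) (u ut : ℝ → ℝ → ℝ) : Prop where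
  mem_left : ∀ t, 0 ≤ t → MemH1 a (u t)
  mem_right : ∀ t, 0 ≤ t → MemLp (ut t) 2 unitMeasure
  continuousOn_u : ContinuousOn (fun t => toL2 (u t)) (Ici 0)
  continuousOn_ux : ContinuousOn (fun t => toL2 (weightedDeriv a (u t))) (Ici 0)
  continuousOn_ut : ContinuousOn (fun t => toL2 (ut t)) (Ici 0)
  integrated : ∀ t, 0 ≤ t → ∃ w z : ℝ → ℝ,
    toL2 w = ∫ s in (0 : ℝ)..t, toL2 (u s) ∧
    toL2 z = ∫ s in (0 : ℝ)..t, toL2 (ut s) ∧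
    WaveOp a w z (fun x => u t x - u 0 x) (fun x => ut t x - ut 0 x)

/-- `(u, ut)` is a classical solution: `U(t) ∈ D(A)` for all `t ≥ 0`, and `U` is continuously
differentiable in the energy space with `U' = A U`, so that `U` is also continuous with values in
`D(A)` (with the graph norm). -/
structure IsClassicalSolution (a : ℝ → ℝ) (u ut : ℝ → ℝ → ℝ) : Prop where
  mem_left : ∀ t, 0 ≤ t → MemH2 a (u t)
  mem_right : ∀ t, 0 ≤ t → MemH1 a (ut t)
  deriv_u : ∀ t, 0 ≤ t →
    HasDerivWithinAt (fun s => toL2 (u s)) (toL2 (ut t)) (Ici 0) t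
  deriv_ux : ∀ t, 0 ≤ t → HasDerivWithinAt (fun s => toL2 (weightedDeriv a (u s)))
    (toL2 (weightedDeriv a (ut t))) (Ici 0) t
  deriv_ut : ∀ t, 0 ≤ t →
    HasDerivWithinAt (fun s => toL2 (ut s)) (toL2 (degenOp a (u t))) (Ici 0) t
  continuousOn_utx : ContinuousOn (fun t => toL2 (weightedDeriv a (ut t))) (Ici 0)
  continuousOn_utt : ContinuousOn (fun t => toL2 (degenOp a (u t))) (Ici 0)

/-- A sequence of classical solutions whose initial data converge, in the norm
`(∫₀¹ (v² + a (u')²))^(1/2)` of the energy space, to the initial data of `(u, ut)`. -/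
structure IsClassicalApproximation (a : ℝ → ℝ) (un utn : ℕ → ℝ → ℝ → ℝ) (u ut : ℝ → ℝ → ℝ) :
    Prop where
  classical : ∀ n, IsClassicalSolution a (un n) (utn n)
  tendsto_ux : Tendsto (fun n => toL2 (weightedDeriv a (un n 0))) atTop
    (𝓝 (toL2 (weightedDeriv a (u 0))))
  tendsto_ut : Tendsto (fun n => toL2 (utn n 0)) atTop (𝓝 (toL2 (ut 0)))

/-- `γ` is (a version of) the normal derivative `u_x(·,1)` of the solution `(u, ut)`, defined by
density: `u_x(t,1)` is the one-sided derivative for classical solutions, and in general `γ` is the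
limit in `L²(0,T)`, for every `T`, of the normal derivatives of the classical solutions whose
initial data converge to those of `(u, ut)`. Such sequences have to exist, so `γ` is unique up to
null sets; constant sequences show that `γ(t) = u_x(t,1)` for almost every `t` if `(u, ut)` is
itself classical. -/
structure IsNormalDerivative (a : ℝ → ℝ) (u ut : ℝ → ℝ → ℝ) (γ : ℝ → ℝ) : Prop where
  aestronglyMeasurable : AEStronglyMeasurable γ (volume.restrict (Ioi 0))
  exists_approximation : ∃ un utn : ℕ → ℝ → ℝ → ℝ, IsClassicalApproximation a un utn u ut
  tendsto : ∀ un utn : ℕ → ℝ → ℝ → ℝ, IsClassicalApproximation a un utn u ut → ∀ T, 0 ≤ T →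
    Tendsto (fun n => eLpNorm (fun t => derivWithin (un n t) (Icc 0 1) 1 - γ t) 2
      (volume.restrict (Ioo 0 T))) atTop (𝓝 0)

/-- The energy `E_u(t) = ½ ∫₀¹ (u_t(t,x)² + a(x) u_x(t,x)²) dx`. -/
def energy (a : ℝ → ℝ) (u ut : ℝ → ℝ → ℝ) (t : ℝ) : ℝ :=
  1 / 2 * ∫ x in (0 : ℝ)..1, (ut t x ^ 2 + a x * deriv (u t) x ^ 2)

end DegenerateWave

end

open MeasureTheory Set Filter Topology

noncomputable section

namespace DegenerateWave

variable {a : ℝ → ℝ}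

/-! The proof is the multiplier method with multiplier `x u_x`, arranged so that every term except
the boundary trace is a bounded form on the energy space. Write `f = √a u_x` and `v = u_t`. Then `x
u_x = (x/√a) f` and `(a - x a') u_x² = (1 - x a'/a) f²`. Since `x|a'| ≤ 2a`, the quotient `a/x²` is
nonincreasing, so `x/√a ≤ 1/√a(1)`; likewise `|1 - x a'/a| ≤ 3`. Hence `crossForm` and `bulkForm`
are continuous on `L² × L²`.

For a classical solution, differentiating `2 ∫ x u_x u_t` in time gives `a(1) u_x(t,1)²` minus the
bulk form (`IsFlux.two_mul_inner_radialMul`, `MemH1.two_mul_inner_radialMul`). No boundary term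
survives at `0`: if `g` is integrable and `x g(x)` has a limit there, that limit is `0`, because
`1/x` is not integrable. The energy is conserved because the operator is skew-symmetric
(`IsFlux.inner_add_inner_eq_zero`). Together these bound the trace in `L²(0,T)` by the initial
energy, and, applied to differences, make it Lipschitz in the initial data.

Mild solutions are reached by averaging in time: the averages over `(t, t+h)` are classical and
converge as `h → 0` (`IsMildSolution.exists_average`). This uses that `w ↦ √a w'` is closed. The
distance between a classical and a mild solution is constant in time, so any approximating sequence
converges at every `t`. The traces are then Cauchy, and the identity passes to the limit by
dominated convergence. No generation theorem for the semigroup is needed. -/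

/-! ### Classes in `L²(0,1)` and multiplication operators -/

lemma toL2_of_memLp {f : ℝ → ℝ} (hf : MemLp f 2 unitMeasure) : toL2 f = hf.toLp f :=
  dif_pos hf

lemma coeFn_toL2 {f : ℝ → ℝ} (hf : MemLp f 2 unitMeasure) : toL2 f =ᵐ[unitMeasure] f := by
  rw [toL2_of_memLp hf]
  exact hf.coeFn_toLp

lemma toL2_coeFn (f : L2) : toL2 f = f := by
  rw [toL2_of_memLp (Lp.memLp f), Lp.toLp_coeFn]

lemma toL2_congr {f g : ℝ → ℝ} (h : f =ᵐ[unitMeasure] g) : toL2 f = toL2 g := by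
  by_cases hf : MemLp f 2 unitMeasure
  · have hg : MemLp g 2 unitMeasure := (memLp_congr_ae h).1 hf
    rw [toL2_of_memLp hf, toL2_of_memLp hg, MemLp.toLp_eq_toLp_iff]
    exact h
  · have hg : ¬ MemLp g 2 unitMeasure := fun hg => hf ((memLp_congr_ae h).2 hg)
    rw [toL2, toL2, dif_neg hf, dif_neg hg]

lemma toL2_sub {f g : ℝ → ℝ} (hf : MemLp f 2 unitMeasure) (hg : MemLp g 2 unitMeasure) :
    toL2 (fun x => f x - g x) = toL2 f - toL2 g := by
  rw [toL2_of_memLp hf, toL2_of_memLp hg, toL2_of_memLp (f := fun x => f x - g x) (hf.sub hg)]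
  rfl

lemma toL2_const_mul (c : ℝ) {f : ℝ → ℝ} (hf : MemLp f 2 unitMeasure) :
    toL2 (fun x => c * f x) = c • toL2 f := by
  rw [toL2_of_memLp hf, toL2_of_memLp (hf.const_mul c)]
  rfl

lemma inner_toL2 {f g : ℝ → ℝ} (hf : MemLp f 2 unitMeasure) (hg : MemLp g 2 unitMeasure) :
    inner ℝ (toL2 f) (toL2 g) = ∫ x, f x * g x ∂unitMeasure := by
  rw [MeasureTheory.L2.inner_def]
  refine integral_congr_ae ?_
  filter_upwards [coeFn_toL2 hf, coeFn_toL2 hg] with x h1 h2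
  rw [h1, h2]
  simp [mul_comm]

lemma norm_sq_toL2 {f : ℝ → ℝ} (hf : MemLp f 2 unitMeasure) :
    ‖toL2 f‖ ^ 2 = ∫ x, f x ^ 2 ∂unitMeasure := by
  rw [← real_inner_self_eq_norm_sq, inner_toL2 hf hf]
  simp only [sq]

lemma memLp_bounded_mul {m f : ℝ → ℝ} (hm : AEStronglyMeasurable m unitMeasure) {C : ℝ}
    (hC : ∀ x ∈ Ioo (0 : ℝ) 1, |m x| ≤ C) (hf : MemLp f 2 unitMeasure) :
    MemLp (fun x => m x * f x) 2 unitMeasure := by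
  refine MemLp.of_le_mul (c := C) hf (hm.mul hf.1) ?_
  filter_upwards [ae_restrict_mem measurableSet_Ioo] with x hx
  rw [norm_mul]
  exact mul_le_mul_of_nonneg_right (hC x hx) (norm_nonneg _)

/-- Multiplication by a bounded measurable function is a bounded operator on `L²(0,1)`. -/
lemma exists_mul_clm {m : ℝ → ℝ} (hm : AEStronglyMeasurable m unitMeasure) {C : ℝ} (hC0 : 0 ≤ C)
    (hC : ∀ x ∈ Ioo (0 : ℝ) 1, |m x| ≤ C) :
    ∃ M : L2 →L[ℝ] L2, ‖M‖ ≤ C ∧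
      ∀ f, MemLp f 2 unitMeasure → M (toL2 f) = toL2 (fun x => m x * f x) := by
  have hmem : ∀ f : L2, MemLp (fun x => m x * f x) 2 unitMeasure := fun f =>
    memLp_bounded_mul hm hC (Lp.memLp f)
  let M₀ : L2 →ₗ[ℝ] L2 :=
    { toFun := fun f => (hmem f).toLp
      map_add' := fun f g => by
        rw [← MemLp.toLp_add, MemLp.toLp_eq_toLp_iff]
        filter_upwards [Lp.coeFn_add f g] with x hx
        simp only [Pi.add_apply, hx, mul_add]
      map_smul' := fun c f => by
        simp only [RingHom.id_apply]
        rw [← MemLp.toLp_const_smul, MemLp.toLp_eq_toLp_iff]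
        filter_upwards [Lp.coeFn_smul c f] with x hx
        simp only [Pi.smul_apply, hx, smul_eq_mul]
        ring }
  have hM₀ : ∀ f, ‖M₀ f‖ ≤ C * ‖f‖ := by
    intro f
    refine Lp.norm_le_mul_norm_of_ae_le_mul ?_
    filter_upwards [(hmem f).coeFn_toLp, ae_restrict_mem measurableSet_Ioo] with x hx hx'
    change ‖(hmem f).toLp _ x‖ ≤ _
    rw [hx, norm_mul]
    exact mul_le_mul_of_nonneg_right (hC x hx') (norm_nonneg _)
  refine ⟨M₀.mkContinuous C hM₀, M₀.mkContinuous_norm_le hC0 hM₀, fun f hf => ?_⟩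
  change (hmem (toL2 f)).toLp _ = _
  rw [← toL2_of_memLp]
  refine toL2_congr ?_
  filter_upwards [coeFn_toL2 hf] with x hx
  rw [hx]

/-! ### Integration by parts on `(0,1)` -/

lemma intervalIntegral_eq_integral_unitMeasure (f : ℝ → ℝ) :
    ∫ x in (0 : ℝ)..1, f x = ∫ x, f x ∂unitMeasure := by
  rw [intervalIntegral.integral_of_le zero_le_one, integral_Ioc_eq_integral_Ioo]

lemma tendsto_intervalIntegral_unitMeasure {f : ℝ → ℝ} (hf : Integrable f unitMeasure) :
    Tendsto (fun ε => ∫ x in ε..1, f x) (𝓝[>] 0) (𝓝 (∫ x, f x ∂unitMeasure)) := by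
  have hf' : IntegrableOn f (uIcc 0 1) := by
    rw [uIcc_of_le zero_le_one, integrableOn_Icc_iff_integrableOn_Ioo]
    exact hf
  have := intervalIntegral.continuousOn_primitive_interval_left hf' 0 (by simp)
  rw [ContinuousWithinAt, intervalIntegral_eq_integral_unitMeasure, uIcc_of_le zero_le_one] at this
  refine this.mono_left ?_
  rw [nhdsWithin_le_iff]
  exact mem_of_superset (Ioo_mem_nhdsGT zero_lt_one) Ioo_subset_Icc_self

/-- The function `1/x` is not integrable at `0`. This one fact removes the boundary terms at the
degenerate end and forces the flux to vanish there under strong degeneracy. -/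
lemma not_integrable_of_inv_le {g : ℝ → ℝ} {c : ℝ} (hc : 0 < c)
    (h : ∀ᶠ x in 𝓝[>] (0 : ℝ), c / x ≤ |g x|) : ¬ Integrable g unitMeasure := by
  intro hg
  obtain ⟨δ, hδ, hsub⟩ := mem_nhdsGT_iff_exists_Ioo_subset.1 h
  set d := min δ 1
  have hd : 0 < d := lt_min hδ one_pos
  have hg' : IntegrableOn g (Ioo 0 d) :=
    IntegrableOn.mono_set (t := Ioo 0 1) hg (Ioo_subset_Ioo_right (min_le_right _ _))
  have hi : IntegrableOn (fun x : ℝ => x⁻¹) (Ioo 0 d) := by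
    refine Integrable.mono' (hg'.norm.const_mul c⁻¹) measurable_inv.aestronglyMeasurable ?_
    filter_upwards [ae_restrict_mem measurableSet_Ioo] with x hx
    have h1 : c / x ≤ |g x| := hsub ⟨hx.1, hx.2.trans_le (min_le_left _ _)⟩
    have hx0 : 0 < x := hx.1
    rw [Real.norm_eq_abs, abs_of_pos (inv_pos.2 hx0), Real.norm_eq_abs]
    calc x⁻¹ = c⁻¹ * (c / x) := by field_simp
      _ ≤ _ := by gcongr
  have := (intervalIntegrable_iff_integrableOn_Ioo_of_le hd.le).2 hi
  rw [intervalIntegrable_inv_iff] at this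
  rcases this with h | h
  · exact hd.ne h
  · exact h (by simp)

/-- Integrate by parts on `[ε,1]` and let `ε → 0`. Nothing is assumed about `f` and `g` separately
at `0`: integrability of `(fg)'` makes the boundary term converge, and its value has to be
identified separately. -/
lemma tendsto_mul_add_integral {f g : ℝ → ℝ}
    (hf : ∀ ε ∈ Ioo (0 : ℝ) 1, AbsolutelyContinuousOnInterval f ε 1)
    (hg : ∀ ε ∈ Ioo (0 : ℝ) 1, AbsolutelyContinuousOnInterval g ε 1)
    (hi : Integrable (fun x => deriv f x * g x + f x * deriv g x) unitMeasure) :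
    Tendsto (fun x => f x * g x) (𝓝[>] 0)
      (𝓝 (f 1 * g 1 - ∫ x, (deriv f x * g x + f x * deriv g x) ∂unitMeasure)) := by
  refine ((tendsto_intervalIntegral_unitMeasure hi).const_sub (f 1 * g 1)).congr' ?_
  filter_upwards [Ioo_mem_nhdsGT zero_lt_one] with ε hε
  rw [(hf ε hε).integral_deriv_mul_eq_sub (hg ε hε)]
  ring

lemma contDiff_absolutelyContinuousOnInterval {f : ℝ → ℝ} (hf : ContDiff ℝ 1 f) (b c : ℝ) :
    AbsolutelyContinuousOnInterval f b c :=
  hf.contDiffOn.absolutelyContinuousOnInterval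

/-- The limit `L` of `x g(x)` exists by integration by parts; if `L ≠ 0`, then `|g| ≥ |L|/(2x)` near
`0`, against integrability. -/
lemma tendsto_id_mul_zero_of_integrable {g : ℝ → ℝ}
    (hg : ∀ ε ∈ Ioo (0 : ℝ) 1, AbsolutelyContinuousOnInterval g ε 1)
    (hi : Integrable g unitMeasure) (hi' : Integrable (fun x => x * deriv g x) unitMeasure) :
    Tendsto (fun x => x * g x) (𝓝[>] 0) (𝓝 0) ∧
      ∫ x, x * deriv g x ∂unitMeasure = g 1 - ∫ x, g x ∂unitMeasure := by
  have hadd : Integrable (fun x => deriv (fun y : ℝ => y) x * g x + x * deriv g x) unitMeasure := by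
    simp only [deriv_id'', one_mul]
    exact hi.add hi'
  have key := tendsto_mul_add_integral (f := fun y => y)
    (fun ε _ => contDiff_absolutelyContinuousOnInterval contDiff_id ε 1) hg hadd
  simp only [deriv_id'', one_mul] at key
  rw [integral_add hi hi'] at key
  set L := g 1 - (∫ x, g x ∂unitMeasure + ∫ x, x * deriv g x ∂unitMeasure) with hL
  have hL0 : L = 0 := by
    by_contra hne
    refine not_integrable_of_inv_le (half_pos (abs_pos.2 hne)) ?_ hi
    have h1 := key.abs.eventually (lt_mem_nhds (half_lt_self (abs_pos.2 hne)))
    filter_upwards [h1, self_mem_nhdsWithin] with x hx hx0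
    have hx0 : 0 < x := hx0
    rw [div_le_iff₀ hx0]
    rw [abs_mul, abs_of_pos hx0] at hx
    linarith
  rw [hL0] at key
  exact ⟨key, by linarith⟩

/-! ### The coefficient -/

namespace IsCoefficient

lemma hasDerivAt (ha : IsCoefficient a) {x : ℝ} (hx : x ∈ Ioo (0 : ℝ) 1) :
    HasDerivAt a (coeffDeriv a x) x := by
  have h : DifferentiableAt ℝ a x :=
    ((ha.contDiffOn.differentiableOn one_ne_zero) x ⟨hx.1, hx.2.le⟩).differentiableAt
      (Ioc_mem_nhds hx.1 hx.2)
  rw [coeffDeriv, derivWithin_of_mem_nhds (Icc_mem_nhds hx.1 hx.2)]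
  exact h.hasDerivAt

lemma continuousOn_coeffDeriv (ha : IsCoefficient a) :
    ContinuousOn (coeffDeriv a) (Ioo 0 1) := by
  have h : ContDiffOn ℝ 1 a (Ioo 0 1) := ha.contDiffOn.mono Ioo_subset_Ioc_self
  refine (h.continuousOn_deriv_of_isOpen isOpen_Ioo le_rfl).congr fun x hx => ?_
  exact (ha.hasDerivAt hx).deriv.symm

lemma continuousOn_Ioo (ha : IsCoefficient a) : ContinuousOn a (Ioo 0 1) :=
  ha.continuousOn.mono Ioo_subset_Icc_self

lemma pos_Ioo (ha : IsCoefficient a) {x : ℝ} (hx : x ∈ Ioo (0 : ℝ) 1) : 0 < a x :=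
  ha.pos x ⟨hx.1, hx.2.le⟩

lemma pos_one (ha : IsCoefficient a) : 0 < a 1 := ha.pos 1 ⟨one_pos, le_rfl⟩

lemma mul_abs_coeffDeriv_le (ha : IsCoefficient a) {x : ℝ} (hx : x ∈ Ioo (0 : ℝ) 1) :
    x * |coeffDeriv a x| ≤ 2 * a x := by
  have h : x * |coeffDeriv a x| / a x ≤ mu a :=
    le_csSup ha.bddAbove ⟨x, ⟨hx.1, hx.2.le⟩, rfl⟩
  have h2 := h.trans ha.mu_lt_two.le
  rwa [div_le_iff₀ (ha.pos_Ioo hx)] at h2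

/-- The bound `x a' ≤ 2a` says that `a/x²` has nonpositive derivative, so it is at least its value
at `1`. -/
lemma mul_sq_le (ha : IsCoefficient a) {x : ℝ} (hx : x ∈ Ioc (0 : ℝ) 1) :
    a 1 * x ^ 2 ≤ a x := by
  have hanti : AntitoneOn (fun y => a y / y ^ 2) (Ioc 0 1) := by
    have hd : ∀ y ∈ Ioo (0 : ℝ) 1, HasDerivAt (fun y => a y / y ^ 2)
        ((coeffDeriv a y * y ^ 2 - a y * (2 * y)) / (y ^ 2) ^ 2) y := by
      intro y hy
      have h2 : HasDerivAt (fun y : ℝ => y ^ 2) (2 * y) y := by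
        simpa using hasDerivAt_pow 2 y
      exact (ha.hasDerivAt hy).fun_div h2 (pow_ne_zero 2 hy.1.ne')
    refine antitoneOn_of_deriv_nonpos (convex_Ioc 0 1) ?_ ?_ ?_
    · refine ContinuousOn.div (ha.continuousOn.mono Ioc_subset_Icc_self) (by fun_prop) ?_
      exact fun y hy => pow_ne_zero 2 hy.1.ne'
    · rw [interior_Ioc]
      exact fun y hy => (hd y hy).differentiableAt.differentiableWithinAt
    · rw [interior_Ioc]
      intro y hy
      rw [(hd y hy).deriv]
      refine div_nonpos_of_nonpos_of_nonneg ?_ (by positivity)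
      have h1 := ha.mul_abs_coeffDeriv_le hy
      have h2 := le_abs_self (coeffDeriv a y)
      have hy0 := hy.1
      nlinarith [mul_le_mul_of_nonneg_left h2 (sq_nonneg y)]
  have := hanti hx ⟨one_pos, le_rfl⟩ hx.2
  simp only [one_pow, div_one] at this
  rwa [le_div_iff₀ (by have := hx.1; positivity)] at this

lemma aestronglyMeasurable_of_continuousOn {f : ℝ → ℝ} (hf : ContinuousOn f (Ioo 0 1)) :
    AEStronglyMeasurable f unitMeasure :=
  hf.aestronglyMeasurable measurableSet_Ioo

lemma continuousOn_sqrt (ha : IsCoefficient a) : ContinuousOn (fun x => √(a x)) (Ioo 0 1) :=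
  ha.continuousOn_Ioo.sqrt

lemma sqrt_pos (ha : IsCoefficient a) {x : ℝ} (hx : x ∈ Ioo (0 : ℝ) 1) : 0 < √(a x) :=
  Real.sqrt_pos.2 (ha.pos_Ioo hx)

lemma memLp_sqrt (ha : IsCoefficient a) : MemLp (fun x => √(a x)) 2 unitMeasure := by
  obtain ⟨C, hC⟩ := isCompact_Icc.exists_bound_of_continuousOn ha.continuousOn.sqrt
  refine MemLp.of_bound (aestronglyMeasurable_of_continuousOn ha.continuousOn_sqrt) C ?_
  filter_upwards [ae_restrict_mem measurableSet_Ioo] with x hx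
  exact hC x (Ioo_subset_Icc_self hx)

lemma abs_div_sqrt_le (ha : IsCoefficient a) {x : ℝ} (hx : x ∈ Ioo (0 : ℝ) 1) :
    |x / √(a x)| ≤ 1 / √(a 1) := by
  have hx0 := hx.1
  rw [abs_of_nonneg (by positivity), div_le_div_iff₀ (ha.sqrt_pos hx) (Real.sqrt_pos.2 ha.pos_one)]
  rw [one_mul, ← Real.sqrt_sq hx0.le, ← Real.sqrt_mul (sq_nonneg x), Real.sqrt_sq hx0.le]
  refine Real.sqrt_le_sqrt ?_
  linarith [ha.mul_sq_le ⟨hx.1, hx.2.le⟩]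

lemma exists_radial_clm (ha : IsCoefficient a) : ∃ M : L2 →L[ℝ] L2, ‖M‖ ≤ 1 / √(a 1) ∧
    ∀ f, MemLp f 2 unitMeasure → M (toL2 f) = toL2 (fun x => x / √(a x) * f x) := by
  refine exists_mul_clm ?_ (by positivity) fun x hx => ha.abs_div_sqrt_le hx
  exact aestronglyMeasurable_of_continuousOn
    (continuousOn_id.div ha.continuousOn_sqrt fun x hx => (ha.sqrt_pos hx).ne')

lemma abs_defect_le (ha : IsCoefficient a) {x : ℝ} (hx : x ∈ Ioo (0 : ℝ) 1) :
    |1 - x * coeffDeriv a x / a x| ≤ 3 := by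
  have h1 : |x * coeffDeriv a x / a x| ≤ 2 := by
    rw [abs_div, abs_mul, abs_of_pos hx.1, abs_of_pos (ha.pos_Ioo hx),
      div_le_iff₀ (ha.pos_Ioo hx)]
    exact ha.mul_abs_coeffDeriv_le hx
  rw [abs_le] at h1 ⊢
  constructor <;> linarith [h1.1, h1.2]

lemma exists_defect_clm (ha : IsCoefficient a) : ∃ N : L2 →L[ℝ] L2, ‖N‖ ≤ 3 ∧
    ∀ f, MemLp f 2 unitMeasure →
      N (toL2 f) = toL2 (fun x => (1 - x * coeffDeriv a x / a x) * f x) := by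
  refine exists_mul_clm ?_ (by norm_num) fun x hx => ?_
  · exact aestronglyMeasurable_of_continuousOn (continuousOn_const.sub
      ((continuousOn_id.mul ha.continuousOn_coeffDeriv).div ha.continuousOn_Ioo
        fun x hx => (ha.pos_Ioo hx).ne'))
  · exact ha.abs_defect_le hx

/-- The operator of multiplication by `x / √a`. -/
def radialMul (ha : IsCoefficient a) : L2 →L[ℝ] L2 := ha.exists_radial_clm.choose

lemma norm_radialMul_le (ha : IsCoefficient a) : ‖ha.radialMul‖ ≤ 1 / √(a 1) :=
  ha.exists_radial_clm.choose_spec.1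

lemma radialMul_toL2 (ha : IsCoefficient a) {f : ℝ → ℝ} (hf : MemLp f 2 unitMeasure) :
    ha.radialMul (toL2 f) = toL2 (fun x => x / √(a x) * f x) :=
  ha.exists_radial_clm.choose_spec.2 f hf

/-- The operator of multiplication by `1 - x a' / a`. -/
def defectMul (ha : IsCoefficient a) : L2 →L[ℝ] L2 := ha.exists_defect_clm.choose

lemma norm_defectMul_le (ha : IsCoefficient a) : ‖ha.defectMul‖ ≤ 3 :=
  ha.exists_defect_clm.choose_spec.1

lemma defectMul_toL2 (ha : IsCoefficient a) {f : ℝ → ℝ} (hf : MemLp f 2 unitMeasure) :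
    ha.defectMul (toL2 f) = toL2 (fun x => (1 - x * coeffDeriv a x / a x) * f x) :=
  ha.exists_defect_clm.choose_spec.2 f hf

/-- For `1 ≤ μ_a < 2` the integer part is `1`, so `a` is `C¹` up to `0`, hence Lipschitz, and `a(0)
= 0`. The regularity assumption with the integer part enters only here. -/
lemma exists_le_mul (ha : IsCoefficient a) (h : 1 ≤ mu a) :
    ∃ K : ℝ, 0 < K ∧ ∀ x ∈ Ioo (0 : ℝ) 1, a x ≤ K * x := by
  have hfl : ⌊mu a⌋₊ = 1 := by
    rw [Nat.floor_eq_iff (by linarith)]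
    refine ⟨by exact_mod_cast h, ?_⟩
    have := ha.mu_lt_two
    norm_num
    linarith
  have hC := ha.contDiffOn_floor
  rw [hfl] at hC
  obtain ⟨K, hK⟩ := ContDiffOn.exists_lipschitzOnWith (by exact_mod_cast hC : ContDiffOn ℝ 1 a _)
    (by norm_num) (convex_Icc 0 1) isCompact_Icc
  -- The Lipschitz constant may be `0`; adding `1` makes the constant positive.
  refine ⟨K + 1, by positivity, fun x hx => ?_⟩
  have := hK.dist_le_mul x (Ioo_subset_Icc_self hx) 0 (by simp)
  rw [ha.zero, Real.dist_eq, Real.dist_eq, sub_zero, sub_zero, abs_of_pos (ha.pos_Ioo hx),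
    abs_of_pos hx.1] at this
  linarith [hx.1]

lemma absolutelyContinuousOnInterval_inv (ha : IsCoefficient a) {ε : ℝ} (hε : ε ∈ Ioo (0 : ℝ) 1) :
    AbsolutelyContinuousOnInterval (fun x => (a x)⁻¹) ε 1 := by
  refine ContDiffOn.absolutelyContinuousOnInterval ?_
  have hsub : uIcc ε 1 ⊆ Ioc 0 1 := by
    rw [uIcc_of_le hε.2.le]
    exact fun x hx => ⟨hε.1.trans_le hx.1, hx.2⟩
  exact (ha.contDiffOn.mono hsub).inv fun x hx => (ha.pos x (hsub hx)).ne'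

end IsCoefficient

/-! ### Functions in the energy space and in the domain of the operator -/

/-- An absolutely continuous function is the primitive of its a.e. derivative, so a continuous
version of that derivative is the derivative everywhere, endpoints included. -/
lemma hasDerivWithinAt_of_ae_deriv_eq {w q : ℝ → ℝ} {ε : ℝ}
    (hε : ε < 1) (hw : AbsolutelyContinuousOnInterval w ε 1) (hq : ContinuousOn q (Icc ε 1))
    (h : ∀ᵐ x, x ∈ Ioo ε 1 → deriv w x = q x) {x : ℝ} (hx : x ∈ Icc ε 1) :
    HasDerivWithinAt w (q x) (Icc ε 1) x := by
  -- A continuous extension to the line lets the two-sided fundamental theorem apply at the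
  -- endpoints as well.
  set Q : ℝ → ℝ := IccExtend hε.le ((Icc ε 1).domRestrict q)
  have hQ : Continuous Q := (continuousOn_iff_continuous_domRestrict.1 hq).Icc_extend'
  have hQq : ∀ y ∈ Icc ε 1, Q y = q y := fun y hy => by
    simp only [Q, IccExtend_of_mem hε.le _ hy, domRestrict_apply]
  have hw' : ∀ y ∈ Icc ε 1, w y = w ε + ∫ s in ε..y, Q s := by
    intro y hy
    have hmono : AbsolutelyContinuousOnInterval w ε y := by
      refine hw.mono ?_
      rw [uIcc_of_le hy.1, uIcc_of_le hε.le]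
      exact Icc_subset_Icc_right hy.2
    have : ∫ s in ε..y, Q s = ∫ s in ε..y, deriv w s := by
      rw [intervalIntegral.integral_of_le hy.1, intervalIntegral.integral_of_le hy.1,
        integral_Ioc_eq_integral_Ioo, integral_Ioc_eq_integral_Ioo]
      refine setIntegral_congr_ae measurableSet_Ioo ?_
      filter_upwards [h] with s hs hsy
      rw [hs ⟨hsy.1, hsy.2.trans_le hy.2⟩, hQq s ⟨hsy.1.le, (hsy.2.trans_le hy.2).le⟩]
    rw [this, hmono.integral_deriv_eq_sub]
    ring
  have hd : HasDerivAt (fun y => w ε + ∫ s in ε..y, Q s) (Q x) x :=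
    ((hQ.integral_hasStrictDerivAt ε x).hasDerivAt).const_add _
  rw [← hQq x hx]
  exact hd.hasDerivWithinAt.congr hw' (hw' x hx)

/-- `p` is the flux `a w'` of `w`. -/
structure IsFlux (a w p : ℝ → ℝ) : Prop where
  ac : AbsolutelyContinuousOnInterval p 0 1
  memLp_deriv : MemLp (deriv p) 2 unitMeasure
  hasDerivAt : ∀ x ∈ Ioo (0 : ℝ) 1, HasDerivAt w (p x / a x) x
  hasDerivWithinAt_one : HasDerivWithinAt w (p 1 / a 1) (Icc 0 1) 1

/-- The definition gives `a w' = p` only almost everywhere. Away from `0` the quotient `p/a` is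
continuous, so `w` is `C¹` up to `x = 1`, which gives the normal derivative a pointwise meaning. -/
lemma MemV2.exists_isFlux (ha : IsCoefficient a) {w : ℝ → ℝ} (hw : MemV2 a w) :
    ∃ p, IsFlux a w p := by
  obtain ⟨p, hp, hp', hpw⟩ := hw.flux
  have hpc : ContinuousOn p (Icc 0 1) := by
    have := hp.continuousOn
    rwa [uIcc_of_le zero_le_one] at this
  have hae : ∀ᵐ x, x ∈ Ioo (0 : ℝ) 1 → deriv w x = p x / a x := by
    rw [← ae_restrict_iff' measurableSet_Ioo]
    filter_upwards [hpw, ae_restrict_mem measurableSet_Ioo] with x hx hx'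
    rw [← hx]
    field_simp [(ha.pos_Ioo hx').ne']
  have key : ∀ ε ∈ Ioo (0 : ℝ) 1, ∀ x ∈ Icc ε 1,
      HasDerivWithinAt w (p x / a x) (Icc ε 1) x := by
    intro ε hε x hx
    have hsub : Icc ε 1 ⊆ Icc 0 1 := Icc_subset_Icc_left hε.1.le
    refine hasDerivWithinAt_of_ae_deriv_eq (q := fun x => p x / a x)
      hε.2 (hw.locallyAC ε hε)
      ((hpc.mono hsub).div (ha.continuousOn.mono hsub)
        fun y hy => (ha.pos y ⟨hε.1.trans_le hy.1, hy.2⟩).ne') ?_ hx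
    filter_upwards [hae] with y hy hy'
    exact hy ⟨hε.1.trans hy'.1, hy'.2⟩
  refine ⟨p, hp, hp', fun x hx => ?_, ?_⟩
  · have hx0 := hx.1
    exact (key (x / 2) ⟨by linarith, by linarith [hx.2]⟩ x ⟨by linarith, hx.2.le⟩).hasDerivAt
      (Icc_mem_nhds (by linarith) hx.2)
  · refine (key (1 / 2) ⟨by norm_num, by norm_num⟩ 1 ⟨by norm_num, le_rfl⟩).mono_of_mem_nhdsWithin ?_
    have : Ici (1 / 2 : ℝ) ∈ 𝓝[Icc 0 1] (1 : ℝ) :=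
      mem_nhdsWithin_of_mem_nhds (Ici_mem_nhds (by norm_num))
    filter_upwards [this, self_mem_nhdsWithin] with y hy hy'
    exact ⟨hy, hy'.2⟩

namespace IsFlux

variable {w p : ℝ → ℝ}

lemma continuousOn (h : IsFlux a w p) : ContinuousOn p (Icc 0 1) := by
  have := h.ac.continuousOn
  rwa [uIcc_of_le zero_le_one] at this

lemma ac_of_mem (h : IsFlux a w p) (ε : ℝ) (hε : ε ∈ Ioo (0 : ℝ) 1) :
    AbsolutelyContinuousOnInterval p ε 1 := by
  refine h.ac.mono ?_
  rw [uIcc_of_le hε.2.le, uIcc_of_le zero_le_one]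
  exact Icc_subset_Icc_left hε.1.le

lemma ae_differentiableAt (h : IsFlux a w p) : ∀ᵐ x ∂unitMeasure, DifferentiableAt ℝ p x := by
  rw [ae_restrict_iff' measurableSet_Ioo]
  filter_upwards [h.ac.ae_differentiableAt] with x hx hx'
  rw [uIcc_of_le zero_le_one] at hx
  exact hx (Ioo_subset_Icc_self hx')

lemma mul_deriv_eq (ha : IsCoefficient a) (h : IsFlux a w p) {x : ℝ} (hx : x ∈ Ioo (0 : ℝ) 1) :
    a x * deriv w x = p x := by
  rw [(h.hasDerivAt x hx).deriv]
  field_simp [(ha.pos_Ioo hx).ne']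

lemma degenOp_eq (ha : IsCoefficient a) (h : IsFlux a w p) {x : ℝ} (hx : x ∈ Ioo (0 : ℝ) 1) :
    degenOp a w x = deriv p x := by
  refine Filter.EventuallyEq.deriv_eq ?_
  filter_upwards [Ioo_mem_nhds hx.1 hx.2] with y hy
  exact h.mul_deriv_eq ha hy

lemma degenOp_ae_eq (ha : IsCoefficient a) (h : IsFlux a w p) :
    degenOp a w =ᵐ[unitMeasure] deriv p := by
  filter_upwards [ae_restrict_mem measurableSet_Ioo] with x hx
  exact h.degenOp_eq ha hx

lemma memLp_degenOp (ha : IsCoefficient a) (h : IsFlux a w p) :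
    MemLp (degenOp a w) 2 unitMeasure :=
  (memLp_congr_ae (h.degenOp_ae_eq ha)).2 h.memLp_deriv

lemma sqrt_mul_weightedDeriv (ha : IsCoefficient a) (h : IsFlux a w p) {x : ℝ}
    (hx : x ∈ Ioo (0 : ℝ) 1) : √(a x) * weightedDeriv a w x = p x := by
  rw [weightedDeriv, ← mul_assoc, Real.mul_self_sqrt (ha.pos_Ioo hx).le, h.mul_deriv_eq ha hx]

lemma derivWithin_one (h : IsFlux a w p) : derivWithin w (Icc 0 1) 1 = p 1 / a 1 :=
  h.hasDerivWithinAt_one.derivWithin (uniqueDiffOn_Icc zero_lt_one 1 (by simp))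

lemma tendsto_zero (h : IsFlux a w p) : Tendsto p (𝓝[>] 0) (𝓝 (p 0)) := by
  refine (h.continuousOn 0 (by simp)).mono_left ?_
  rw [nhdsWithin_le_iff]
  exact mem_of_superset (Ioo_mem_nhdsGT zero_lt_one) Ioo_subset_Icc_self

lemma integrable (h : IsFlux a w p) : Integrable p unitMeasure :=
  IntegrableOn.mono_set (h.continuousOn.integrableOn_compact isCompact_Icc) Ioo_subset_Icc_self

/-- Cauchy–Schwarz for `p(x) = ∫₀ˣ p'`, written as the inner product of `p'` with the indicator of
`(0,x)`. -/
lemma sq_le_mul (h : IsFlux a w p) (h0 : p 0 = 0) {x : ℝ} (hx : x ∈ Ioo (0 : ℝ) 1) :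
    p x ^ 2 ≤ x * ‖toL2 (deriv p)‖ ^ 2 := by
  have hmono : AbsolutelyContinuousOnInterval p 0 x := by
    refine h.ac.mono ?_
    rw [uIcc_of_le hx.1.le, uIcc_of_le zero_le_one]
    exact Icc_subset_Icc_right hx.2.le
  have hμ : unitMeasure (Ioo 0 x) ≠ ⊤ := measure_ne_top _ _
  have hres : unitMeasure.restrict (Ioo 0 x) = volume.restrict (Ioo 0 x) := by
    rw [Measure.restrict_restrict measurableSet_Ioo,
      inter_eq_self_of_subset_left (Ioo_subset_Ioo_right hx.2.le)]
  have hin : inner ℝ (indicatorConstLp 2 measurableSet_Ioo hμ (1 : ℝ)) (toL2 (deriv p)) = p x := by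
    rw [MeasureTheory.L2.inner_indicatorConstLp_one]
    have h1 := hmono.integral_deriv_eq_sub
    rw [h0, sub_zero, intervalIntegral.integral_of_le hx.1.le, integral_Ioc_eq_integral_Ioo] at h1
    rw [← h1, ← hres]
    exact integral_congr_ae (ae_restrict_of_ae (coeFn_toL2 h.memLp_deriv))
  have hn : ‖indicatorConstLp 2 measurableSet_Ioo hμ (1 : ℝ)‖ ^ 2 = x := by
    rw [norm_indicatorConstLp (by norm_num) (by norm_num), measureReal_restrict_apply measurableSet_Ioo,
      inter_eq_self_of_subset_left (Ioo_subset_Ioo_right hx.2.le), Real.volume_real_Ioo_of_le hx.1.le]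
    rw [norm_one, one_mul, sub_zero, ENNReal.toReal_ofNat, ← Real.sqrt_eq_rpow, Real.sq_sqrt hx.1.le]
  have hcs := abs_real_inner_le_norm (indicatorConstLp 2 measurableSet_Ioo hμ (1 : ℝ))
    (toL2 (deriv p))
  rw [hin] at hcs
  calc p x ^ 2 = |p x| ^ 2 := (sq_abs _).symm
    _ ≤ (‖indicatorConstLp 2 measurableSet_Ioo hμ (1 : ℝ)‖ * ‖toL2 (deriv p)‖) ^ 2 := by
      gcongr
    _ = _ := by rw [mul_pow, hn]

end IsFlux

lemma MemV1.ae_differentiableAt {w : ℝ → ℝ} (hw : MemV1 a w) :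
    ∀ᵐ x ∂unitMeasure, DifferentiableAt ℝ w x := by
  rw [ae_restrict_iff' measurableSet_Ioo]
  -- Countably many intervals exhaust `(0,1)`; the shift by `2` keeps the left endpoint below `1`
  -- even for `n = 0`.
  have : ∀ n : ℕ, ∀ᵐ x, x ∈ uIcc (1 / ((n : ℝ) + 2)) 1 → DifferentiableAt ℝ w x := fun n => by
    have hn : (1 : ℝ) < n + 2 := by linarith [(Nat.cast_nonneg n : (0 : ℝ) ≤ n)]
    exact (hw.locallyAC _ ⟨by positivity, (div_lt_one (by positivity)).2 hn⟩).ae_differentiableAt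
  filter_upwards [ae_all_iff.2 this] with x hx hx'
  obtain ⟨n, hn⟩ := exists_nat_gt (1 / x)
  refine hx n ?_
  rw [mem_uIcc]
  left
  refine ⟨?_, hx'.2.le⟩
  rw [div_le_iff₀ (by positivity)]
  rw [div_lt_iff₀ hx'.1] at hn
  nlinarith [hx'.1]

lemma MemV1.deriv_mul_self_ae {v : ℝ → ℝ} (hv : MemV1 a v) :
    (fun x => deriv (fun y => v y * v y) x) =ᵐ[unitMeasure] fun x => 2 * (v x * deriv v x) := by
  filter_upwards [hv.ae_differentiableAt] with x hx
  rw [deriv_fun_mul hx hx]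
  ring

lemma MemV1.memLp_id_mul_deriv (ha : IsCoefficient a) {v : ℝ → ℝ} (hv : MemV1 a v) :
    MemLp (fun x => x * deriv v x) 2 unitMeasure ∧
      ha.radialMul (toL2 (weightedDeriv a v)) = toL2 (fun x => x * deriv v x) := by
  have heq : (fun x => x / √(a x) * weightedDeriv a v x) =ᵐ[unitMeasure] fun x => x * deriv v x := by
    filter_upwards [ae_restrict_mem measurableSet_Ioo] with x hx
    have := (ha.sqrt_pos hx).ne'
    rw [weightedDeriv]
    field_simp
  refine ⟨?_, ?_⟩
  · refine (memLp_congr_ae heq).1 (memLp_bounded_mul ?_ (fun x hx => ha.abs_div_sqrt_le hx)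
      hv.memLp_weightedDeriv)
    exact IsCoefficient.aestronglyMeasurable_of_continuousOn
      (continuousOn_id.div ha.continuousOn_sqrt fun x hx => (ha.sqrt_pos hx).ne')
  · rw [ha.radialMul_toL2 hv.memLp_weightedDeriv]
    exact toL2_congr heq

/-- For `v ∈ V¹_a(0,1)` one has `x v² → 0` at `0`, and `x v' v` integrates to
`(v(1)² - ‖v‖²) / 2`. -/
lemma MemV1.radial (ha : IsCoefficient a) {v : ℝ → ℝ} (hv : MemV1 a v) :
    Tendsto (fun x => x * (v x * v x)) (𝓝[>] 0) (𝓝 0) ∧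
      2 * inner ℝ (ha.radialMul (toL2 (weightedDeriv a v))) (toL2 v) = v 1 ^ 2 - ‖toL2 v‖ ^ 2 := by
  obtain ⟨hm, heq⟩ := hv.memLp_id_mul_deriv ha
  have hprod : Integrable (fun x => x * deriv v x * v x) unitMeasure :=
    MemLp.integrable_mul (p := 2) (q := 2) hm hv.memLp
  have hcong : (fun x => x * deriv (fun y => v y * v y) x) =ᵐ[unitMeasure]
      fun x => 2 * (x * deriv v x * v x) := by
    filter_upwards [hv.deriv_mul_self_ae] with x hx
    rw [hx]
    ring
  -- Here `g = v²`, and `x g' = 2 (x v') v` is integrable because `x v'` is in `L²`.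
  obtain ⟨h1, h2⟩ := tendsto_id_mul_zero_of_integrable (g := fun x => v x * v x)
    (fun ε hε => (hv.locallyAC ε hε).fun_mul (hv.locallyAC ε hε))
    (MemLp.integrable_mul (p := 2) (q := 2) hv.memLp hv.memLp)
    ((integrable_congr hcong).2 (hprod.const_mul 2))
  refine ⟨h1, ?_⟩
  rw [heq, inner_toL2 hm hv.memLp, ← integral_const_mul, ← integral_congr_ae hcong, h2,
    norm_sq_toL2 hv.memLp]
  simp only [sq]

lemma MemH1.two_mul_inner_radialMul (ha : IsCoefficient a) {v : ℝ → ℝ} (hv : MemH1 a v) :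
    2 * inner ℝ (ha.radialMul (toL2 (weightedDeriv a v))) (toL2 v) = - ‖toL2 v‖ ^ 2 := by
  rw [(hv.toMemV1.radial ha).2, hv.at_one]
  ring

/-- If `p(0) ≠ 0`, then `a w'² = p²/a ≥ c/x` near `0` because `a ≤ Kx`, contradicting `√a w' ∈ L²`.
The Neumann condition at `0` is thus automatic in the strongly degenerate case, although the domain
does not list it. -/
lemma IsFlux.zero_of_one_le_mu (ha : IsCoefficient a) {w p : ℝ → ℝ} (h : IsFlux a w p)
    (hw : MemV1 a w) (hmu : 1 ≤ mu a) : p 0 = 0 := by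
  by_contra hne
  obtain ⟨K, hK, hKa⟩ := ha.exists_le_mul hmu
  have hi : Integrable (fun x => weightedDeriv a w x * weightedDeriv a w x) unitMeasure :=
    MemLp.integrable_mul (p := 2) (q := 2) hw.memLp_weightedDeriv hw.memLp_weightedDeriv
  have hpos : 0 < p 0 ^ 2 / 2 := by positivity
  refine not_integrable_of_inv_le (div_pos hpos hK) ?_ hi
  have h1 := (h.tendsto_zero.pow 2).eventually (lt_mem_nhds (half_lt_self (by positivity)))
  filter_upwards [h1, Ioo_mem_nhdsGT zero_lt_one] with x hx hx'
  have hax := ha.pos_Ioo hx'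
  have hsq : weightedDeriv a w x * weightedDeriv a w x = p x ^ 2 / a x := by
    rw [← h.sqrt_mul_weightedDeriv ha hx', mul_pow, Real.sq_sqrt hax.le]
    field_simp
  rw [hsq, abs_of_nonneg (by positivity), div_div]
  have := hx'.1
  exact div_le_div₀ (by positivity) hx.le hax (hKa x hx')

/-- The wave operator is skew-symmetric in the energy space. -/
lemma IsFlux.inner_add_inner_eq_zero (ha : IsCoefficient a) {w p v : ℝ → ℝ} (h : IsFlux a w p)
    (hw : MemV1 a w) (hv : MemH1 a v) :
    inner ℝ (toL2 (weightedDeriv a v)) (toL2 (weightedDeriv a w)) +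
      inner ℝ (toL2 v) (toL2 (degenOp a w)) = 0 := by
  have hvi : Integrable (fun x => weightedDeriv a v x * weightedDeriv a w x) unitMeasure :=
    MemLp.integrable_mul (p := 2) (q := 2) hv.memLp_weightedDeriv hw.memLp_weightedDeriv
  have hdi : Integrable (fun x => v x * degenOp a w x) unitMeasure :=
    MemLp.integrable_mul (p := 2) (q := 2) hv.memLp (h.memLp_degenOp ha)
  rw [inner_toL2 hv.memLp_weightedDeriv hw.memLp_weightedDeriv,
    inner_toL2 hv.memLp (h.memLp_degenOp ha), ← integral_add hvi hdi]
  have hcong : (fun x => weightedDeriv a v x * weightedDeriv a w x + v x * degenOp a w x)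
      =ᵐ[unitMeasure] fun x => deriv v x * p x + v x * deriv p x := by
    filter_upwards [ae_restrict_mem measurableSet_Ioo] with x hx
    rw [h.degenOp_eq ha hx, ← h.sqrt_mul_weightedDeriv ha hx]
    simp only [weightedDeriv]
    ring
  rw [integral_congr_ae hcong]
  have hlim := tendsto_mul_add_integral hv.locallyAC h.ac_of_mem
    ((integrable_congr hcong).1 (hvi.add hdi))
  have hzero : Tendsto (fun x => v x * p x) (𝓝[>] 0) (𝓝 0) := by
    -- For `μ_a < 1` the factor `v` tends to `0` and `p` converges. For `μ_a ≥ 1` one has `p² ≤ x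
    -- ‖p'‖²`, so `(v p)² ≤ x v² ‖p'‖²`, and `x v² → 0`.
    rcases lt_or_ge (mu a) 1 with hmu | hmu
    · simpa using (hv.at_zero hmu).mul h.tendsto_zero
    · have hp0 := h.zero_of_one_le_mu ha hw hmu
      have hx := ((hv.toMemV1.radial ha).1.mul_const (‖toL2 (deriv p)‖ ^ 2)).sqrt
      rw [zero_mul, Real.sqrt_zero] at hx
      refine squeeze_zero_norm' ?_ hx
      filter_upwards [Ioo_mem_nhdsGT zero_lt_one] with x hx
      rw [Real.norm_eq_abs]
      refine Real.abs_le_sqrt ?_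
      have := mul_le_mul_of_nonneg_left (h.sq_le_mul hp0 hx) (sq_nonneg (v x))
      nlinarith
  have := tendsto_nhds_unique hlim hzero
  rw [hv.at_one, zero_mul] at this
  linarith

lemma MemV1.memLp_defect (ha : IsCoefficient a) {w : ℝ → ℝ} (hw : MemV1 a w) :
    MemLp (fun x => (1 - x * coeffDeriv a x / a x) * weightedDeriv a w x) 2 unitMeasure := by
  refine memLp_bounded_mul (C := 3) ?_ (fun x hx => ?_) hw.memLp_weightedDeriv
  · exact IsCoefficient.aestronglyMeasurable_of_continuousOn (continuousOn_const.sub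
      ((continuousOn_id.mul ha.continuousOn_coeffDeriv).div ha.continuousOn_Ioo
        fun x hx => (ha.pos_Ioo hx).ne'))
  · exact ha.abs_defect_le hx

/-- The multiplier `x w'` tested against `(a w')'`. -/
lemma IsFlux.two_mul_inner_radialMul (ha : IsCoefficient a) {w p : ℝ → ℝ} (h : IsFlux a w p)
    (hw : MemV1 a w) :
    2 * inner ℝ (ha.radialMul (toL2 (weightedDeriv a w))) (toL2 (degenOp a w)) =
      a 1 * derivWithin w (Icc 0 1) 1 ^ 2 -
        inner ℝ (ha.defectMul (toL2 (weightedDeriv a w))) (toL2 (weightedDeriv a w)) := by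
  obtain ⟨hm, heq⟩ := hw.memLp_id_mul_deriv ha
  have hN := hw.memLp_defect ha
  have hi₁ : Integrable (fun x => x * deriv w x * degenOp a w x) unitMeasure :=
    MemLp.integrable_mul (p := 2) (q := 2) hm (h.memLp_degenOp ha)
  have hi₂ : Integrable (fun x => (1 - x * coeffDeriv a x / a x) * weightedDeriv a w x *
      weightedDeriv a w x) unitMeasure :=
    MemLp.integrable_mul (p := 2) (q := 2) hN hw.memLp_weightedDeriv
  have hi₃ : Integrable (fun x => weightedDeriv a w x * weightedDeriv a w x) unitMeasure :=
    MemLp.integrable_mul (p := 2) (q := 2) hw.memLp_weightedDeriv hw.memLp_weightedDeriv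
  -- The function integrated by parts is `a w'²`; writing it as `p²/a` shows that it is absolutely
  -- continuous away from `0`.
  have hg : (fun x => weightedDeriv a w x * weightedDeriv a w x) =ᵐ[unitMeasure]
      fun x => p x * p x * (a x)⁻¹ := by
    filter_upwards [ae_restrict_mem measurableSet_Ioo] with x hx
    have hax := ha.pos_Ioo hx
    have : p x * p x = a x * (weightedDeriv a w x * weightedDeriv a w x) := by
      rw [← h.sqrt_mul_weightedDeriv ha hx]
      linear_combination (weightedDeriv a w x) ^ 2 * Real.mul_self_sqrt hax.le
    rw [this]
    field_simp
  -- With `g = p²/a`, one has `x g' = 2 x w' p' - (x a'/a) g`; adding and subtracting `g` produces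
  -- the weight `1 - x a'/a`.
  have hdg : (fun x => x * deriv (fun y => p y * p y * (a y)⁻¹) x) =ᵐ[unitMeasure]
      fun x => 2 * (x * deriv w x * degenOp a w x) + (1 - x * coeffDeriv a x / a x) *
        weightedDeriv a w x * weightedDeriv a w x - weightedDeriv a w x * weightedDeriv a w x := by
    filter_upwards [ae_restrict_mem measurableSet_Ioo, h.ae_differentiableAt, hg] with x hx hpx hgx
    have hax := (ha.pos_Ioo hx).ne'
    have hd := ((hpx.hasDerivAt.fun_mul hpx.hasDerivAt).fun_mul ((ha.hasDerivAt hx).fun_inv hax))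
    rw [hd.deriv, h.degenOp_eq ha hx, (h.hasDerivAt x hx).deriv, mul_assoc (1 - _), hgx]
    field_simp
    ring
  have hi₁₂ : Integrable (fun x => 2 * (x * deriv w x * degenOp a w x) +
      (1 - x * coeffDeriv a x / a x) * weightedDeriv a w x * weightedDeriv a w x) unitMeasure :=
    (hi₁.const_mul 2).add hi₂
  obtain ⟨-, h2⟩ := tendsto_id_mul_zero_of_integrable (g := fun x => p x * p x * (a x)⁻¹)
    (fun ε hε => ((h.ac_of_mem ε hε).fun_mul (h.ac_of_mem ε hε)).fun_mul
      (ha.absolutelyContinuousOnInterval_inv hε))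
    ((integrable_congr hg).1 hi₃) ((integrable_congr hdg).2 (hi₁₂.sub hi₃))
  rw [integral_congr_ae hdg, ← integral_congr_ae hg,
    integral_sub hi₁₂ hi₃, integral_add (hi₁.const_mul 2) hi₂,
    integral_const_mul] at h2
  rw [heq, inner_toL2 hm (h.memLp_degenOp ha), ha.defectMul_toL2 hw.memLp_weightedDeriv,
    inner_toL2 hN hw.memLp_weightedDeriv, h.derivWithin_one]
  have ha1 := ha.pos_one.ne'
  have : a 1 * (p 1 / a 1) ^ 2 = p 1 * p 1 * (a 1)⁻¹ := by
    field_simp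
  rw [this]
  linarith

lemma memLp_id : MemLp (fun x : ℝ => x) 2 unitMeasure := by
  refine MemLp.of_bound measurable_id.aestronglyMeasurable 1 ?_
  filter_upwards [ae_restrict_mem measurableSet_Ioo] with x hx
  rw [Real.norm_eq_abs, abs_of_pos hx.1]
  exact hx.2.le

/-- The trace `w'(1)` as a continuous functional of `√a w'` and `(a w')'`. -/
lemma IsFlux.mul_derivWithin_one (ha : IsCoefficient a) {w p : ℝ → ℝ} (h : IsFlux a w p)
    (hw : MemV1 a w) :
    a 1 * derivWithin w (Icc 0 1) 1 = inner ℝ (toL2 (fun x => x)) (toL2 (degenOp a w)) +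
      inner ℝ (toL2 fun x => √(a x)) (toL2 (weightedDeriv a w)) := by
  have hi₁ : Integrable (fun x => x * deriv p x) unitMeasure :=
    MemLp.integrable_mul (p := 2) (q := 2) memLp_id h.memLp_deriv
  -- This is `p(1) = ∫ x p' + ∫ p`, where `p(1) = a(1) w'(1)`.
  obtain ⟨-, h2⟩ := tendsto_id_mul_zero_of_integrable h.ac_of_mem h.integrable hi₁
  rw [inner_toL2 memLp_id (h.memLp_degenOp ha), inner_toL2 ha.memLp_sqrt hw.memLp_weightedDeriv,
    h.derivWithin_one, mul_div_cancel₀ _ ha.pos_one.ne']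
  have e1 : ∫ x, x * degenOp a w x ∂unitMeasure = ∫ x, x * deriv p x ∂unitMeasure := by
    refine integral_congr_ae ?_
    filter_upwards [h.degenOp_ae_eq ha] with x hx
    rw [hx]
  have e2 : ∫ x, √(a x) * weightedDeriv a w x ∂unitMeasure = ∫ x, p x ∂unitMeasure := by
    refine integral_congr_ae ?_
    filter_upwards [ae_restrict_mem measurableSet_Ioo] with x hx
    exact h.sqrt_mul_weightedDeriv ha hx
  rw [e1, e2]
  linarith

/-- Weak characterization of `√a w'`. -/
lemma MemV1.inner_weightedDeriv_eq (ha : IsCoefficient a) {w ψ : ℝ → ℝ} (hw : MemV1 a w)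
    (hψ : ContDiff ℝ 1 ψ) (hs : tsupport ψ ⊆ Ioo 0 1)
    (hψa : MemLp (fun x => ψ x / √(a x)) 2 unitMeasure)
    (hψ' : MemLp (deriv ψ) 2 unitMeasure) :
    inner ℝ (toL2 fun x => ψ x / √(a x)) (toL2 (weightedDeriv a w)) =
      - inner ℝ (toL2 (deriv ψ)) (toL2 w) := by
  have hi₁ : Integrable (fun x => ψ x / √(a x) * weightedDeriv a w x) unitMeasure :=
    MemLp.integrable_mul (p := 2) (q := 2) hψa hw.memLp_weightedDeriv
  have hi₂ : Integrable (fun x => deriv ψ x * w x) unitMeasure :=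
    MemLp.integrable_mul (p := 2) (q := 2) hψ' hw.memLp
  have hcong : (fun x => deriv ψ x * w x + ψ x / √(a x) * weightedDeriv a w x) =ᵐ[unitMeasure]
      fun x => deriv ψ x * w x + ψ x * deriv w x := by
    filter_upwards [ae_restrict_mem measurableSet_Ioo] with x hx
    have := (ha.sqrt_pos hx).ne'
    rw [weightedDeriv]
    field_simp
  have hlim := tendsto_mul_add_integral
    (fun ε _ => contDiff_absolutelyContinuousOnInterval hψ ε 1) hw.locallyAC
    ((integrable_congr hcong).1 (hi₂.add hi₁))
  have hzero : Tendsto (fun x => ψ x * w x) (𝓝[>] 0) (𝓝 0) := by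
    refine Tendsto.congr' ?_ tendsto_const_nhds
    have h0 : (0 : ℝ) ∉ tsupport ψ := fun h => lt_irrefl _ (hs h).1
    have := notMem_tsupport_iff_eventuallyEq.1 h0
    filter_upwards [nhdsWithin_le_nhds this] with x hx
    rw [hx]
    simp
  have h1 : ψ 1 = 0 := by
    by_contra h
    exact lt_irrefl _ (hs (subset_tsupport _ h)).2
  have := tendsto_nhds_unique hlim hzero
  rw [h1, zero_mul, ← integral_congr_ae hcong, integral_add hi₂ hi₁] at this
  rw [inner_toL2 hψa hw.memLp_weightedDeriv, inner_toL2 hψ' hw.memLp]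
  linarith

lemma memLp_test_div_sqrt (ha : IsCoefficient a) {ψ : ℝ → ℝ} (hψ : Continuous ψ)
    (hc : HasCompactSupport ψ) (hs : tsupport ψ ⊆ Ioo 0 1) :
    MemLp (fun x => ψ x / √(a x)) 2 unitMeasure := by
  have hcont : ContinuousOn (fun x => ψ x / √(a x)) (Ioo 0 1) :=
    hψ.continuousOn.div ha.continuousOn_sqrt fun x hx => (ha.sqrt_pos hx).ne'
  obtain ⟨C, hC⟩ := hc.isCompact.exists_bound_of_continuousOn (hcont.mono hs)
  refine MemLp.of_bound (IsCoefficient.aestronglyMeasurable_of_continuousOn hcont) (max C 0)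
    (Eventually.of_forall fun x => ?_)
  by_cases hx : x ∈ tsupport ψ
  · exact (hC x hx).trans (le_max_left _ _)
  · rw [image_eq_zero_of_notMem_tsupport hx]
    simp

lemma memLp_of_hasCompactSupport {ψ : ℝ → ℝ} (hψ : Continuous ψ) (hc : HasCompactSupport ψ) :
    MemLp ψ 2 unitMeasure :=
  (hψ.memLp_of_hasCompactSupport hc).restrict _

/-- The operator `w ↦ √a w'` is closed, in the form of its compatibility with integrals. -/
lemma toL2_weightedDeriv_eq_integral (ha : IsCoefficient a) {u : ℝ → ℝ → ℝ} {w : ℝ → ℝ} {t : ℝ}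
    (ht : 0 ≤ t) (hu : ∀ s, 0 ≤ s → MemV1 a (u s))
    (hcu : ContinuousOn (fun s => toL2 (u s)) (Ici 0))
    (hcx : ContinuousOn (fun s => toL2 (weightedDeriv a (u s))) (Ici 0)) (hw : MemV1 a w)
    (hint : toL2 w = ∫ s in (0 : ℝ)..t, toL2 (u s)) :
    toL2 (weightedDeriv a w) = ∫ s in (0 : ℝ)..t, toL2 (weightedDeriv a (u s)) := by
  have hsub : uIcc 0 t ⊆ Ici 0 := by
    rw [uIcc_of_le ht]
    exact Icc_subset_Ici_self
  have hiu : IntervalIntegrable (fun s => toL2 (u s)) volume 0 t :=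
    (hcu.mono hsub).intervalIntegrable
  have hix : IntervalIntegrable (fun s => toL2 (weightedDeriv a (u s))) volume 0 t :=
    (hcx.mono hsub).intervalIntegrable
  set G : L2 := ∫ s in (0 : ℝ)..t, toL2 (weightedDeriv a (u s)) with hG
  have hpair : ∀ (χ : L2) {f : ℝ → L2}, IntervalIntegrable f volume 0 t →
      inner ℝ χ (∫ s in (0 : ℝ)..t, f s) = ∫ s in (0 : ℝ)..t, inner ℝ χ (f s) := fun χ f hf =>
    ((innerSL ℝ χ).intervalIntegral_comp_comm hf).symm
  set H : ℝ → ℝ := fun x => weightedDeriv a w x - G x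
  have hH : MemLp H 2 unitMeasure := hw.memLp_weightedDeriv.sub (Lp.memLp G)
  have hHG : toL2 H = toL2 (weightedDeriv a w) - G := by
    rw [toL2_sub hw.memLp_weightedDeriv (Lp.memLp G), toL2_coeFn]
  have hloc : LocallyIntegrableOn (fun x => H x / √(a x)) (Ioo 0 1) := by
    have h1 : LocallyIntegrableOn H (Ioo 0 1) :=
      IntegrableOn.locallyIntegrableOn (hH.integrable (by norm_num))
    have h2 : ContinuousOn (fun x => (√(a x))⁻¹) (Ioo 0 1) :=
      ha.continuousOn_sqrt.inv₀ fun x hx => (ha.sqrt_pos hx).ne'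
    simpa only [div_eq_mul_inv] using h1.mul_continuousOn h2 isOpen_Ioo.isLocallyClosed
  -- Pairing with `ψ/√a` moves the derivative onto the test function `ψ`, after which the pairing
  -- involves only `w` and the `u s` and commutes with the time integral. Hence `H/√a` vanishes as a
  -- distribution.
  have hzero := isOpen_Ioo.ae_eq_zero_of_integral_contDiff_smul_eq_zero hloc (fun ψ hψ hc hs => by
    have hψ1 : ContDiff ℝ 1 ψ := hψ.of_le (by exact_mod_cast le_top)
    have hψa := memLp_test_div_sqrt ha hψ1.continuous hc hs
    have hψ' : MemLp (deriv ψ) 2 unitMeasure :=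
      memLp_of_hasCompactSupport (hψ1.continuous_deriv le_rfl) hc.deriv
    have h1 : ∫ x, ψ x • (H x / √(a x)) = ∫ x, ψ x / √(a x) * H x ∂unitMeasure := by
      rw [setIntegral_eq_integral_of_forall_compl_eq_zero]
      · refine integral_congr_ae (Eventually.of_forall fun x => ?_)
        simp only [smul_eq_mul]
        ring
      · intro x hx
        rw [image_eq_zero_of_notMem_tsupport fun h => hx (hs h)]
        simp
    rw [h1, ← inner_toL2 hψa hH, hHG, inner_sub_right, hw.inner_weightedDeriv_eq ha hψ1 hs hψa hψ',
      hint, hpair _ hiu, hG, hpair _ hix, ← intervalIntegral.integral_neg, sub_eq_zero]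
    refine intervalIntegral.integral_congr fun s hs' => ?_
    exact ((hu s (hsub hs')).inner_weightedDeriv_eq ha hψ1 hs hψa hψ').symm)
  have hH0 : H =ᵐ[unitMeasure] fun _ => 0 := by
    rw [← ae_restrict_iff' measurableSet_Ioo] at hzero
    filter_upwards [hzero, ae_restrict_mem measurableSet_Ioo] with x hx hx'
    exact (div_eq_zero_iff.1 hx).resolve_right (ha.sqrt_pos hx').ne'
  rw [← sub_eq_zero, ← hHG, toL2_congr hH0, toL2_of_memLp (MemLp.zero' : MemLp (fun _ => (0 : ℝ)) 2 _)]
  exact MemLp.toLp_zero _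

/-! ### Linear combinations -/

/-- The single combination `c (f - g)` serves two purposes: differences of solutions with `c = 1`,
and time averages with `c = h⁻¹`. -/
lemma memLp_smul_sub {f g : ℝ → ℝ} (c : ℝ) (hf : MemLp f 2 unitMeasure)
    (hg : MemLp g 2 unitMeasure) : MemLp (fun x => c * (f x - g x)) 2 unitMeasure :=
  (hf.sub hg).const_mul c

lemma toL2_smul_sub {f g : ℝ → ℝ} (c : ℝ) (hf : MemLp f 2 unitMeasure)
    (hg : MemLp g 2 unitMeasure) :
    toL2 (fun x => c * (f x - g x)) = c • (toL2 f - toL2 g) := by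
  rw [toL2_const_mul (f := fun x => f x - g x) c (hf.sub hg), toL2_sub hf hg]

lemma absolutelyContinuousOnInterval_smul_sub {f g : ℝ → ℝ} (c : ℝ) {b d : ℝ}
    (hf : AbsolutelyContinuousOnInterval f b d) (hg : AbsolutelyContinuousOnInterval g b d) :
    AbsolutelyContinuousOnInterval (fun x => c * (f x - g x)) b d :=
  (hf.fun_sub hg).const_mul c

lemma MemV1.weightedDeriv_smul_sub_ae {f g : ℝ → ℝ} (c : ℝ) (hf : MemV1 a f) (hg : MemV1 a g) :
    weightedDeriv a (fun x => c * (f x - g x)) =ᵐ[unitMeasure]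
      fun x => c * (weightedDeriv a f x - weightedDeriv a g x) := by
  filter_upwards [hf.ae_differentiableAt, hg.ae_differentiableAt] with x hfx hgx
  rw [weightedDeriv, ((hfx.hasDerivAt.fun_sub hgx.hasDerivAt).const_mul c).deriv]
  simp only [weightedDeriv]
  ring

lemma MemV1.smul_sub {f g : ℝ → ℝ} (c : ℝ) (hf : MemV1 a f) (hg : MemV1 a g) :
    MemV1 a (fun x => c * (f x - g x)) where
  memLp := memLp_smul_sub c hf.memLp hg.memLp
  locallyAC := fun ε hε =>
    absolutelyContinuousOnInterval_smul_sub c (hf.locallyAC ε hε) (hg.locallyAC ε hε)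
  memLp_weightedDeriv := (memLp_congr_ae (hf.weightedDeriv_smul_sub_ae c hg)).2
    (memLp_smul_sub c hf.memLp_weightedDeriv hg.memLp_weightedDeriv)

lemma MemV1.toL2_weightedDeriv_smul_sub {f g : ℝ → ℝ} (c : ℝ) (hf : MemV1 a f)
    (hg : MemV1 a g) :
    toL2 (weightedDeriv a (fun x => c * (f x - g x))) =
      c • (toL2 (weightedDeriv a f) - toL2 (weightedDeriv a g)) := by
  rw [toL2_congr (hf.weightedDeriv_smul_sub_ae c hg),
    toL2_smul_sub c hf.memLp_weightedDeriv hg.memLp_weightedDeriv]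

lemma MemH1.smul_sub {f g : ℝ → ℝ} (c : ℝ) (hf : MemH1 a f) (hg : MemH1 a g) :
    MemH1 a (fun x => c * (f x - g x)) where
  toMemV1 := hf.toMemV1.smul_sub c hg.toMemV1
  at_one := by simp [hf.at_one, hg.at_one]
  at_zero := fun h => by simpa using ((hf.at_zero h).sub (hg.at_zero h)).const_mul c

lemma IsFlux.deriv_smul_sub_ae {f g p q : ℝ → ℝ} (c : ℝ) (hf : IsFlux a f p) (hg : IsFlux a g q) :
    deriv (fun x => c * (p x - q x)) =ᵐ[unitMeasure] fun x => c * (deriv p x - deriv q x) := by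
  filter_upwards [hf.ae_differentiableAt, hg.ae_differentiableAt] with x hfx hgx
  exact ((hfx.hasDerivAt.fun_sub hgx.hasDerivAt).const_mul c).deriv

lemma IsFlux.smul_sub {f g p q : ℝ → ℝ} (c : ℝ) (hf : IsFlux a f p) (hg : IsFlux a g q) :
    IsFlux a (fun x => c * (f x - g x)) (fun x => c * (p x - q x)) where
  ac := absolutelyContinuousOnInterval_smul_sub c hf.ac hg.ac
  memLp_deriv := (memLp_congr_ae (hf.deriv_smul_sub_ae c hg)).2
    (memLp_smul_sub c hf.memLp_deriv hg.memLp_deriv)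
  hasDerivAt := fun x hx => by
    rw [mul_div_assoc, sub_div]
    exact ((hf.hasDerivAt x hx).fun_sub (hg.hasDerivAt x hx)).const_mul c
  hasDerivWithinAt_one := by
    rw [mul_div_assoc, sub_div]
    exact (hf.hasDerivWithinAt_one.fun_sub hg.hasDerivWithinAt_one).const_mul c

lemma IsFlux.memV2 (ha : IsCoefficient a) {w p : ℝ → ℝ} (h : IsFlux a w p) (hw : MemV1 a w) :
    MemV2 a w where
  toMemV1 := hw
  flux := ⟨p, h.ac, h.memLp_deriv, by
    filter_upwards [ae_restrict_mem measurableSet_Ioo] with x hx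
    exact h.mul_deriv_eq ha hx⟩

lemma MemV2.memLp_degenOp (ha : IsCoefficient a) {w : ℝ → ℝ} (hw : MemV2 a w) :
    MemLp (degenOp a w) 2 unitMeasure := by
  obtain ⟨p, hp⟩ := hw.exists_isFlux ha
  exact hp.memLp_degenOp ha

lemma MemH2.smul_sub (ha : IsCoefficient a) {f g : ℝ → ℝ} (c : ℝ) (hf : MemH2 a f)
    (hg : MemH2 a g) : MemH2 a (fun x => c * (f x - g x)) := by
  obtain ⟨p, hp⟩ := hf.1.exists_isFlux ha
  obtain ⟨q, hq⟩ := hg.1.exists_isFlux ha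
  exact ⟨(hp.smul_sub c hq).memV2 ha (hf.1.toMemV1.smul_sub c hg.1.toMemV1), hf.2.smul_sub c hg.2⟩

lemma MemV2.toL2_degenOp_smul_sub (ha : IsCoefficient a) {f g : ℝ → ℝ} (c : ℝ) (hf : MemV2 a f)
    (hg : MemV2 a g) :
    toL2 (degenOp a (fun x => c * (f x - g x))) =
      c • (toL2 (degenOp a f) - toL2 (degenOp a g)) := by
  obtain ⟨p, hp⟩ := hf.exists_isFlux ha
  obtain ⟨q, hq⟩ := hg.exists_isFlux ha
  rw [toL2_congr ((hp.smul_sub c hq).degenOp_ae_eq ha), toL2_congr (hp.deriv_smul_sub_ae c hq),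
    toL2_smul_sub c hp.memLp_deriv hq.memLp_deriv, toL2_congr (hp.degenOp_ae_eq ha),
    toL2_congr (hq.degenOp_ae_eq ha)]

lemma MemV2.derivWithin_one_smul_sub (ha : IsCoefficient a) {f g : ℝ → ℝ} (c : ℝ) (hf : MemV2 a f)
    (hg : MemV2 a g) :
    derivWithin (fun x => c * (f x - g x)) (Icc 0 1) 1 =
      c * (derivWithin f (Icc 0 1) 1 - derivWithin g (Icc 0 1) 1) := by
  obtain ⟨p, hp⟩ := hf.exists_isFlux ha
  obtain ⟨q, hq⟩ := hg.exists_isFlux ha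
  rw [(hp.smul_sub c hq).derivWithin_one, hp.derivWithin_one, hq.derivWithin_one]
  ring

/-! ### Classical solutions -/

/-- The quadratic form `∫ (v² + (1 - x a'/a) f²)` on pairs `(f, v)`. -/
def bulkForm (ha : IsCoefficient a) (f v : L2) : ℝ := ‖v‖ ^ 2 + inner ℝ (ha.defectMul f) f

/-- The form `∫ (x / √a) f v` on pairs `(f, v)`. -/
def crossForm (ha : IsCoefficient a) (f v : L2) : ℝ := inner ℝ (ha.radialMul f) v

lemma tendsto_bulkForm (ha : IsCoefficient a) {ι : Type*} {l : Filter ι} {f v : ι → L2} {f₀ v₀ : L2}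
    (hf : Tendsto f l (𝓝 f₀)) (hv : Tendsto v l (𝓝 v₀)) :
    Tendsto (fun i => bulkForm ha (f i) (v i)) l (𝓝 (bulkForm ha f₀ v₀)) :=
  (hv.norm.pow 2).add (((ha.defectMul.continuous.tendsto f₀).comp hf).inner hf)

lemma tendsto_crossForm (ha : IsCoefficient a) {ι : Type*} {l : Filter ι} {f v : ι → L2}
    {f₀ v₀ : L2} (hf : Tendsto f l (𝓝 f₀)) (hv : Tendsto v l (𝓝 v₀)) :
    Tendsto (fun i => crossForm ha (f i) (v i)) l (𝓝 (crossForm ha f₀ v₀)) :=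
  ((ha.radialMul.continuous.tendsto f₀).comp hf).inner hv

lemma abs_bulkForm_le (ha : IsCoefficient a) (f v : L2) :
    |bulkForm ha f v| ≤ 3 * (‖f‖ ^ 2 + ‖v‖ ^ 2) := by
  have h1 : |inner ℝ (ha.defectMul f) f| ≤ 3 * ‖f‖ ^ 2 := by
    refine (abs_real_inner_le_norm _ _).trans ?_
    rw [sq, ← mul_assoc]
    gcongr
    exact ha.defectMul.le_of_opNorm_le ha.norm_defectMul_le f
  rw [abs_le] at h1 ⊢
  unfold bulkForm
  constructor <;> nlinarith [h1.1, h1.2, sq_nonneg ‖v‖]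

lemma two_mul_abs_crossForm_le (ha : IsCoefficient a) (f v : L2) :
    2 * |crossForm ha f v| ≤ 1 / √(a 1) * (‖f‖ ^ 2 + ‖v‖ ^ 2) := by
  have h1 : |crossForm ha f v| ≤ 1 / √(a 1) * ‖f‖ * ‖v‖ := by
    refine (abs_real_inner_le_norm _ _).trans ?_
    gcongr
    exact ha.radialMul.le_of_opNorm_le ha.norm_radialMul_le f
  have h2 : 0 ≤ 1 / √(a 1) := by positivity
  nlinarith [mul_nonneg h2 (sq_nonneg (‖f‖ - ‖v‖))]

namespace IsClassicalSolution

variable {u ut v vt : ℝ → ℝ → ℝ}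

lemma smul_sub (ha : IsCoefficient a) (c : ℝ) (hu : IsClassicalSolution a u ut)
    (hv : IsClassicalSolution a v vt) :
    IsClassicalSolution a (fun t x => c * (u t x - v t x)) (fun t x => c * (ut t x - vt t x)) := by
  have e₁ : EqOn (fun t => toL2 (fun x => c * (u t x - v t x)))
      (fun t => c • (toL2 (u t) - toL2 (v t))) (Ici 0) := fun t ht =>
    toL2_smul_sub c (hu.mem_left t ht).2.memLp (hv.mem_left t ht).2.memLp
  have e₂ : EqOn (fun t => toL2 (weightedDeriv a (fun x => c * (u t x - v t x))))
      (fun t => c • (toL2 (weightedDeriv a (u t)) - toL2 (weightedDeriv a (v t)))) (Ici 0) :=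
    fun t ht => (hu.mem_left t ht).2.toMemV1.toL2_weightedDeriv_smul_sub c
      (hv.mem_left t ht).2.toMemV1
  have e₃ : EqOn (fun t => toL2 (fun x => c * (ut t x - vt t x)))
      (fun t => c • (toL2 (ut t) - toL2 (vt t))) (Ici 0) := fun t ht =>
    toL2_smul_sub c (hu.mem_right t ht).memLp (hv.mem_right t ht).memLp
  have e₄ : EqOn (fun t => toL2 (weightedDeriv a (fun x => c * (ut t x - vt t x))))
      (fun t => c • (toL2 (weightedDeriv a (ut t)) - toL2 (weightedDeriv a (vt t)))) (Ici 0) :=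
    fun t ht => (hu.mem_right t ht).toMemV1.toL2_weightedDeriv_smul_sub c
      (hv.mem_right t ht).toMemV1
  have e₅ : EqOn (fun t => toL2 (degenOp a (fun x => c * (u t x - v t x))))
      (fun t => c • (toL2 (degenOp a (u t)) - toL2 (degenOp a (v t)))) (Ici 0) :=
    fun t ht => (hu.mem_left t ht).1.toL2_degenOp_smul_sub ha c (hv.mem_left t ht).1
  refine ⟨fun t ht => (hu.mem_left t ht).smul_sub ha c (hv.mem_left t ht),
    fun t ht => (hu.mem_right t ht).smul_sub c (hv.mem_right t ht), fun t ht => ?_, fun t ht => ?_,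
    fun t ht => ?_, ?_, ?_⟩
  · exact ((((hu.deriv_u t ht).fun_sub (hv.deriv_u t ht)).fun_const_smul c).congr_deriv
      (e₃ ht).symm).congr e₁ (e₁ ht)
  · exact ((((hu.deriv_ux t ht).fun_sub (hv.deriv_ux t ht)).fun_const_smul c).congr_deriv
      (e₄ ht).symm).congr e₂ (e₂ ht)
  · exact ((((hu.deriv_ut t ht).fun_sub (hv.deriv_ut t ht)).fun_const_smul c).congr_deriv
      (e₅ ht).symm).congr e₃ (e₃ ht)
  · exact ((hu.continuousOn_utx.fun_sub hv.continuousOn_utx).const_smul c).congr e₄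
  · exact ((hu.continuousOn_utt.fun_sub hv.continuousOn_utt).const_smul c).congr e₅

lemma continuousOn_ux (hu : IsClassicalSolution a u ut) :
    ContinuousOn (fun t => toL2 (weightedDeriv a (u t))) (Ici 0) :=
  fun t ht => (hu.deriv_ux t ht).continuousWithinAt

lemma continuousOn_ut (hu : IsClassicalSolution a u ut) :
    ContinuousOn (fun t => toL2 (ut t)) (Ici 0) :=
  fun t ht => (hu.deriv_ut t ht).continuousWithinAt

/-- The time derivative is twice the pairing that vanishes by skew-symmetry of the operator. -/
lemma energy_conservation (ha : IsCoefficient a) (hu : IsClassicalSolution a u ut) {t : ℝ}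
    (ht : 0 ≤ t) :
    ‖toL2 (weightedDeriv a (u t))‖ ^ 2 + ‖toL2 (ut t)‖ ^ 2 =
      ‖toL2 (weightedDeriv a (u 0))‖ ^ 2 + ‖toL2 (ut 0)‖ ^ 2 := by
  have hd : ∀ s, 0 ≤ s → HasDerivWithinAt
      (fun s => ‖toL2 (weightedDeriv a (u s))‖ ^ 2 + ‖toL2 (ut s)‖ ^ 2) 0 (Ici 0) s := by
    intro s hs
    refine ((hu.deriv_ux s hs).norm_sq.fun_add (hu.deriv_ut s hs).norm_sq).congr_deriv ?_
    obtain ⟨p, hp⟩ := (hu.mem_left s hs).1.exists_isFlux ha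
    have := hp.inner_add_inner_eq_zero ha (hu.mem_left s hs).1.toMemV1 (hu.mem_right s hs)
    rw [real_inner_comm] at this
    linarith
  refine constant_of_has_deriv_right_zero (a := 0) (b := t)
    (f := fun s => ‖toL2 (weightedDeriv a (u s))‖ ^ 2 + ‖toL2 (ut s)‖ ^ 2) ?_ ?_ t ⟨ht, le_rfl⟩
  · exact fun s hs => ((hd s hs.1).continuousWithinAt).mono Icc_subset_Ici_self
  · exact fun s hs => (hd s hs.1).mono (Ici_subset_Ici.2 hs.1)

/-- The trace is a bounded linear functional of `√a u_x` and `(a u_x)_x`, both continuous in time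
for a classical solution. -/
lemma continuousOn_trace (ha : IsCoefficient a) (hu : IsClassicalSolution a u ut) :
    ContinuousOn (fun t => derivWithin (u t) (Icc 0 1) 1) (Ici 0) := by
  have h : ContinuousOn (fun t => (a 1)⁻¹ * (inner ℝ (toL2 (fun x => x)) (toL2 (degenOp a (u t))) +
      inner ℝ (toL2 fun x => √(a x)) (toL2 (weightedDeriv a (u t))))) (Ici 0) :=
    ((continuousOn_const.inner hu.continuousOn_utt).fun_add
      (continuousOn_const.inner hu.continuousOn_ux)).const_mul _
  refine h.congr fun t ht => ?_
  obtain ⟨p, hp⟩ := (hu.mem_left t ht).1.exists_isFlux ha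
  beta_reduce
  rw [← hp.mul_derivWithin_one ha (hu.mem_left t ht).1.toMemV1, inv_mul_cancel_left₀ ha.pos_one.ne']

lemma continuousOn_bulkForm (ha : IsCoefficient a) (hu : IsClassicalSolution a u ut) :
    ContinuousOn (fun t => bulkForm ha (toL2 (weightedDeriv a (u t))) (toL2 (ut t))) (Ici 0) :=
  fun t ht => tendsto_bulkForm ha (hu.continuousOn_ux t ht) (hu.continuousOn_ut t ht)

/-- The multiplier identity for classical solutions. -/
lemma multiplier_identity (ha : IsCoefficient a) (hu : IsClassicalSolution a u ut) {T : ℝ}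
    (hT : 0 ≤ T) :
    a 1 * (∫ t in (0 : ℝ)..T, derivWithin (u t) (Icc 0 1) 1 ^ 2) =
      (∫ t in (0 : ℝ)..T, bulkForm ha (toL2 (weightedDeriv a (u t))) (toL2 (ut t))) +
        2 * (crossForm ha (toL2 (weightedDeriv a (u T))) (toL2 (ut T)) -
          crossForm ha (toL2 (weightedDeriv a (u 0))) (toL2 (ut 0))) := by
  have hsub : uIcc 0 T ⊆ Ici 0 := by
    rw [uIcc_of_le hT]
    exact Icc_subset_Ici_self
  set F : ℝ → ℝ := fun t => 2 * crossForm ha (toL2 (weightedDeriv a (u t))) (toL2 (ut t))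
  set f : ℝ → ℝ := fun t => a 1 * derivWithin (u t) (Icc 0 1) 1 ^ 2 -
    bulkForm ha (toL2 (weightedDeriv a (u t))) (toL2 (ut t))
  have hF : ∀ t, 0 ≤ t → HasDerivWithinAt F (f t) (Ici 0) t := by
    intro t ht
    have hM : HasDerivWithinAt (fun s => ha.radialMul (toL2 (weightedDeriv a (u s))))
        (ha.radialMul (toL2 (weightedDeriv a (ut t)))) (Ici 0) t :=
      ha.radialMul.hasFDerivAt.comp_hasDerivWithinAt t (hu.deriv_ux t ht)
    refine ((hM.inner ℝ (hu.deriv_ut t ht)).const_mul 2).congr_deriv ?_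
    obtain ⟨p, hp⟩ := (hu.mem_left t ht).1.exists_isFlux ha
    -- The derivative of `F` has two parts. The pairing of `x u_x` with `u_tt = (a u_x)_x` yields
    -- the trace minus the defect term (`h1`); that of `x u_tx` with `u_t` yields `-‖u_t‖²`, since
    -- `u_t` vanishes at `1` (`h2`).
    have h1 := hp.two_mul_inner_radialMul ha (hu.mem_left t ht).1.toMemV1
    have h2 := (hu.mem_right t ht).two_mul_inner_radialMul ha
    simp only [f, bulkForm]
    linarith
  have htr : ContinuousOn (fun t => derivWithin (u t) (Icc 0 1) 1 ^ 2) (uIcc 0 T) :=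
    ((hu.continuousOn_trace ha).mono hsub).pow 2
  have hbk := (hu.continuousOn_bulkForm ha).mono hsub
  have hint : ∫ t in (0 : ℝ)..T, f t = F T - F 0 := by
    refine intervalIntegral.integral_eq_sub_of_hasDeriv_right ?_ ?_ ?_
    · exact fun t ht => (hF t (hsub ht)).continuousWithinAt.mono hsub
    · rw [min_eq_left hT]
      exact fun t ht => (hF t ht.1.le).mono (Ioi_subset_Ici ht.1.le)
    · exact ((htr.const_mul _).fun_sub hbk).intervalIntegrable
  rw [intervalIntegral.integral_sub (htr.const_mul _).intervalIntegrable hbk.intervalIntegrable,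
    intervalIntegral.integral_const_mul] at hint
  simp only [F] at hint
  linarith

/-- Both forms are bounded by the conserved energy. Applied to differences of classical solutions,
this controls the trace by the initial data. -/
lemma integral_trace_sq_le (ha : IsCoefficient a) (hu : IsClassicalSolution a u ut) {T : ℝ}
    (hT : 0 ≤ T) :
    a 1 * (∫ t in (0 : ℝ)..T, derivWithin (u t) (Icc 0 1) 1 ^ 2) ≤
      (3 * T + 2 / √(a 1)) * (‖toL2 (weightedDeriv a (u 0))‖ ^ 2 + ‖toL2 (ut 0)‖ ^ 2) := by
  set S := ‖toL2 (weightedDeriv a (u 0))‖ ^ 2 + ‖toL2 (ut 0)‖ ^ 2 with hS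
  rw [hu.multiplier_identity ha hT]
  have h1 : ‖∫ t in (0 : ℝ)..T, bulkForm ha (toL2 (weightedDeriv a (u t))) (toL2 (ut t))‖ ≤
      3 * S * |T - 0| := by
    refine intervalIntegral.norm_integral_le_of_norm_le_const fun t ht => ?_
    rw [uIoc_of_le hT] at ht
    rw [hS, ← hu.energy_conservation ha ht.1.le]
    exact abs_bulkForm_le ha _ _
  rw [sub_zero, abs_of_nonneg hT] at h1
  have h2 := two_mul_abs_crossForm_le ha (toL2 (weightedDeriv a (u T))) (toL2 (ut T))
  have h3 := two_mul_abs_crossForm_le ha (toL2 (weightedDeriv a (u 0))) (toL2 (ut 0))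
  rw [hu.energy_conservation ha hT] at h2
  have h4 := le_abs_self (crossForm ha (toL2 (weightedDeriv a (u T))) (toL2 (ut T)))
  have h5 := neg_abs_le (crossForm ha (toL2 (weightedDeriv a (u 0))) (toL2 (ut 0)))
  have h6 := (le_abs_self _).trans h1
  have h7 : (3 * T + 2 / √(a 1)) * S = 3 * S * T + 2 * (1 / √(a 1) * S) := by ring
  rw [h7]
  linarith

end IsClassicalSolution

/-! ### Mild solutions -/

/-- Both functions are continuous on `(0,1)`, so a.e. equality is equality there and the derivatives
coincide at every point. -/
lemma weightedDeriv_ae_eq_of_ae_eq {f g : ℝ → ℝ} (hf : MemV1 a f) (hg : MemV1 a g)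
    (h : f =ᵐ[unitMeasure] g) : weightedDeriv a f =ᵐ[unitMeasure] weightedDeriv a g := by
  have hcont : ∀ {w : ℝ → ℝ}, MemV1 a w → ContinuousOn w (Ioo 0 1) := by
    intro w hw x hx
    have hx0 := hx.1
    have hε : x / 2 ∈ Ioo (0 : ℝ) 1 := ⟨by linarith, by linarith [hx.2]⟩
    have := (hw.locallyAC _ hε).continuousOn
    rw [uIcc_of_le hε.2.le] at this
    exact (this.continuousAt (Icc_mem_nhds (by linarith) hx.2)).continuousWithinAt
  have heq := Measure.eqOn_open_of_ae_eq h isOpen_Ioo (hcont hf) (hcont hg)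
  filter_upwards [ae_restrict_mem measurableSet_Ioo] with x hx
  simp only [weightedDeriv]
  rw [Filter.EventuallyEq.deriv_eq (heq.eventuallyEq_of_mem (isOpen_Ioo.mem_nhds hx))]

/-- The average of `f` over `(t, t + h)`. -/
def timeAverage (f : ℝ → L2) (h t : ℝ) : L2 :=
  h⁻¹ • ((∫ s in (0 : ℝ)..(t + h), f s) - ∫ s in (0 : ℝ)..t, f s)

/-- Freezing `f` at its value at `0` for negative times gives a continuous function on the line,
whose primitive is differentiable on both sides even at `t = 0`. -/
lemma exists_hasDerivAt_primitive {f : ℝ → L2} (hf : ContinuousOn f (Ici 0)) :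
    ∃ I : ℝ → L2, (∀ t, 0 ≤ t → ∫ s in (0 : ℝ)..t, f s = I t) ∧
      ∀ t, 0 ≤ t → HasDerivAt I (f t) t := by
  have hg : Continuous fun s => f (max s 0) :=
    hf.comp_continuous (by fun_prop) fun s => le_max_right s 0
  refine ⟨fun t => ∫ s in (0 : ℝ)..t, f (max s 0), fun t ht => ?_, fun t ht => ?_⟩
  · refine intervalIntegral.integral_congr fun s hs => ?_
    rw [uIcc_of_le ht] at hs
    simp only [max_eq_left hs.1]
  · have := (hg.integral_hasStrictDerivAt 0 t).hasDerivAt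
    rwa [max_eq_left ht] at this

lemma hasDerivWithinAt_timeAverage {f : ℝ → L2} (hf : ContinuousOn f (Ici 0)) {h : ℝ} (hh : 0 ≤ h)
    {t : ℝ} (ht : 0 ≤ t) :
    HasDerivWithinAt (timeAverage f h) (h⁻¹ • (f (t + h) - f t)) (Ici 0) t := by
  obtain ⟨I, hI, hd⟩ := exists_hasDerivAt_primitive hf
  have h1 := (((hd (t + h) (by linarith)).comp_add_const t h).fun_sub (hd t ht)).fun_const_smul h⁻¹
  refine h1.hasDerivWithinAt.congr (fun s hs => ?_) ?_
  · rw [timeAverage, hI _ (add_nonneg hs hh), hI _ hs]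
  · rw [timeAverage, hI _ (add_nonneg ht hh), hI _ ht]

lemma tendsto_timeAverage {f : ℝ → L2} (hf : ContinuousOn f (Ici 0)) {t : ℝ} (ht : 0 ≤ t) :
    Tendsto (fun h => timeAverage f h t) (𝓝[>] 0) (𝓝 (f t)) := by
  obtain ⟨I, hI, hd⟩ := exists_hasDerivAt_primitive hf
  have h1 := (hd t ht).tendsto_slope_zero_right
  refine h1.congr' ?_
  filter_upwards [self_mem_nhdsWithin] with h hh
  rw [timeAverage, hI _ (add_nonneg ht (le_of_lt hh)), hI _ ht]

/-- Time averages of mild solutions are classical solutions. -/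
lemma IsMildSolution.exists_average (ha : IsCoefficient a) {u ut : ℝ → ℝ → ℝ}
    (hu : IsMildSolution a u ut) {h : ℝ} (hh : 0 ≤ h) :
    ∃ v vt : ℝ → ℝ → ℝ, IsClassicalSolution a v vt ∧ ∀ t, 0 ≤ t →
      toL2 (weightedDeriv a (v t)) = timeAverage (fun s => toL2 (weightedDeriv a (u s))) h t ∧
      toL2 (vt t) = timeAverage (fun s => toL2 (ut s)) h t := by
  have hex : ∀ t, ∃ w z : ℝ → ℝ, 0 ≤ t → toL2 w = ∫ s in (0 : ℝ)..t, toL2 (u s) ∧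
      toL2 z = ∫ s in (0 : ℝ)..t, toL2 (ut s) ∧
      WaveOp a w z (fun x => u t x - u 0 x) (fun x => ut t x - ut 0 x) := by
    intro t
    by_cases ht : 0 ≤ t
    · obtain ⟨w, z, hwz⟩ := hu.integrated t ht
      exact ⟨w, z, fun _ => hwz⟩
    · exact ⟨0, 0, fun h => absurd h ht⟩
  choose w z hwz using hex
  have hw : ∀ t, 0 ≤ t → MemH2 a (w t) := fun t ht => (hwz t ht).2.2.mem_left
  have hz : ∀ t, 0 ≤ t → MemH1 a (z t) := fun t ht => (hwz t ht).2.2.mem_right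
  have hshift : ∀ {t : ℝ}, 0 ≤ t → 0 ≤ t + h := fun ht => add_nonneg ht hh
  -- The mild formulation identifies only `w` with an integral; closedness of `w ↦ √a w'` supplies
  -- the same for the weighted derivative. The next facts read `z = u(t) - u(0)` and `(a w')' =
  -- u_t(t) - u_t(0)` off the operator equation.
  have hwx : ∀ t, 0 ≤ t → toL2 (weightedDeriv a (w t)) =
      ∫ s in (0 : ℝ)..t, toL2 (weightedDeriv a (u s)) := fun t ht =>
    toL2_weightedDeriv_eq_integral ha ht (fun s hs => (hu.mem_left s hs).toMemV1)
      hu.continuousOn_u hu.continuousOn_ux (hw t ht).2.toMemV1 (hwz t ht).1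
  have hzu : ∀ t, 0 ≤ t → toL2 (z t) = toL2 (u t) - toL2 (u 0) := fun t ht => by
    rw [← toL2_sub (hu.mem_left t ht).memLp (hu.mem_left 0 le_rfl).memLp]
    exact (toL2_congr (hwz t ht).2.2.eq_left).symm
  have hzx : ∀ t, 0 ≤ t → toL2 (weightedDeriv a (z t)) =
      toL2 (weightedDeriv a (u t)) - toL2 (weightedDeriv a (u 0)) := fun t ht => by
    have h1 := (hu.mem_left t ht).toMemV1
    have h2 := (hu.mem_left 0 le_rfl).toMemV1
    have h3 := h1.toL2_weightedDeriv_smul_sub 1 h2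
    rw [one_smul] at h3
    rw [← h3]
    refine toL2_congr (weightedDeriv_ae_eq_of_ae_eq (hz t ht).toMemV1 (h1.smul_sub 1 h2) ?_)
    filter_upwards [(hwz t ht).2.2.eq_left] with x hx
    rw [← hx, one_mul]
  have hwd : ∀ t, 0 ≤ t → toL2 (degenOp a (w t)) = toL2 (ut t) - toL2 (ut 0) := fun t ht => by
    rw [← toL2_sub (hu.mem_right t ht) (hu.mem_right 0 le_rfl)]
    exact (toL2_congr (hwz t ht).2.2.eq_right).symm
  -- The averaged solution is the difference quotient of the pair `(w, z)`: it lies in the domain at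
  -- each time and represents the time average of `(u, u_t)`.
  have e₁ : EqOn (fun t => toL2 (fun x => h⁻¹ * (w (t + h) x - w t x)))
      (timeAverage (fun s => toL2 (u s)) h) (Ici 0) := fun t ht => by
    simp only
    rw [toL2_smul_sub _ (hw _ (hshift ht)).2.memLp (hw t ht).2.memLp, (hwz _ (hshift ht)).1,
      (hwz t ht).1, timeAverage]
  have e₂ : EqOn (fun t => toL2 (weightedDeriv a (fun x => h⁻¹ * (w (t + h) x - w t x))))
      (timeAverage (fun s => toL2 (weightedDeriv a (u s))) h) (Ici 0) := fun t ht => by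
    simp only
    rw [(hw _ (hshift ht)).2.toMemV1.toL2_weightedDeriv_smul_sub _ (hw t ht).2.toMemV1,
      hwx _ (hshift ht), hwx t ht, timeAverage]
  have e₃ : EqOn (fun t => toL2 (fun x => h⁻¹ * (z (t + h) x - z t x)))
      (timeAverage (fun s => toL2 (ut s)) h) (Ici 0) := fun t ht => by
    simp only
    rw [toL2_smul_sub _ (hz _ (hshift ht)).memLp (hz t ht).memLp, (hwz _ (hshift ht)).2.1,
      (hwz t ht).2.1, timeAverage]
  have d₁ : ∀ t, 0 ≤ t → toL2 (fun x => h⁻¹ * (z (t + h) x - z t x)) =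
      h⁻¹ • (toL2 (u (t + h)) - toL2 (u t)) := fun t ht => by
    rw [toL2_smul_sub _ (hz _ (hshift ht)).memLp (hz t ht).memLp, hzu _ (hshift ht), hzu t ht,
      sub_sub_sub_cancel_right]
  have d₂ : EqOn (fun t => toL2 (weightedDeriv a (fun x => h⁻¹ * (z (t + h) x - z t x))))
      (fun t => h⁻¹ • (toL2 (weightedDeriv a (u (t + h))) - toL2 (weightedDeriv a (u t))))
      (Ici 0) := fun t ht => by
    simp only
    rw [(hz _ (hshift ht)).toMemV1.toL2_weightedDeriv_smul_sub _ (hz t ht).toMemV1,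
      hzx _ (hshift ht), hzx t ht, sub_sub_sub_cancel_right]
  have d₃ : EqOn (fun t => toL2 (degenOp a (fun x => h⁻¹ * (w (t + h) x - w t x))))
      (fun t => h⁻¹ • (toL2 (ut (t + h)) - toL2 (ut t))) (Ici 0) := fun t ht => by
    simp only
    rw [(hw _ (hshift ht)).1.toL2_degenOp_smul_sub ha _ (hw t ht).1, hwd _ (hshift ht), hwd t ht,
      sub_sub_sub_cancel_right]
  have hcs : ∀ {f : ℝ → L2}, ContinuousOn f (Ici 0) →
      ContinuousOn (fun t => h⁻¹ • (f (t + h) - f t)) (Ici 0) := fun hf =>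
    ((hf.comp (g := _) (f := fun t => t + h) (by fun_prop) fun t ht => hshift ht).fun_sub hf).const_smul h⁻¹
  refine ⟨fun t x => h⁻¹ * (w (t + h) x - w t x), fun t x => h⁻¹ * (z (t + h) x - z t x),
    ⟨fun t ht => (hw _ (hshift ht)).smul_sub ha _ (hw t ht),
      fun t ht => (hz _ (hshift ht)).smul_sub _ (hz t ht), fun t ht => ?_, fun t ht => ?_,
      fun t ht => ?_, ?_, ?_⟩, fun t ht => ⟨e₂ ht, e₃ ht⟩⟩
  · exact ((hasDerivWithinAt_timeAverage hu.continuousOn_u hh ht).congr_deriv (d₁ t ht).symm).congr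
      e₁ (e₁ ht)
  · exact ((hasDerivWithinAt_timeAverage hu.continuousOn_ux hh ht).congr_deriv (d₂ ht).symm).congr
      e₂ (e₂ ht)
  · exact ((hasDerivWithinAt_timeAverage hu.continuousOn_ut hh ht).congr_deriv (d₃ ht).symm).congr
      e₃ (e₃ ht)
  · exact (hcs hu.continuousOn_ux).congr d₂
  · exact (hcs hu.continuousOn_ut).congr d₃

/-- The squared distance in the energy space of `(u(t), u_t(t))` and `(v(t), v_t(t))`. -/
def energyDist (a : ℝ → ℝ) (u ut v vt : ℝ → ℝ → ℝ) (t : ℝ) : ℝ :=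
  ‖toL2 (weightedDeriv a (u t)) - toL2 (weightedDeriv a (v t))‖ ^ 2 + ‖toL2 (ut t) - toL2 (vt t)‖ ^ 2

lemma tendsto_energyDist {u ut : ℝ → ℝ → ℝ} {un utn : ℕ → ℝ → ℝ → ℝ} {t : ℝ}
    (h₁ : Tendsto (fun n => toL2 (weightedDeriv a (un n t))) atTop (𝓝 (toL2 (weightedDeriv a (u t)))))
    (h₂ : Tendsto (fun n => toL2 (utn n t)) atTop (𝓝 (toL2 (ut t)))) :
    Tendsto (fun n => energyDist a (un n) (utn n) u ut t) atTop (𝓝 0) := by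
  have := ((h₁.sub_const (toL2 (weightedDeriv a (u t)))).norm.pow 2).add
    ((h₂.sub_const (toL2 (ut t))).norm.pow 2)
  simp only [sub_self, norm_zero, ne_eq, OfNat.ofNat_ne_zero, not_false_eq_true, zero_pow,
    add_zero] at this
  exact this

lemma IsClassicalSolution.energyDist_sub {u ut v vt : ℝ → ℝ → ℝ}
    (hu : IsClassicalSolution a u ut) (hv : IsClassicalSolution a v vt) {t : ℝ} (ht : 0 ≤ t) :
    ‖toL2 (weightedDeriv a (fun x => 1 * (u t x - v t x)))‖ ^ 2 +
      ‖toL2 (fun x => 1 * (ut t x - vt t x))‖ ^ 2 = energyDist a u ut v vt t := by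
  rw [(hu.mem_left t ht).2.toMemV1.toL2_weightedDeriv_smul_sub 1 (hv.mem_left t ht).2.toMemV1,
    toL2_smul_sub 1 (hu.mem_right t ht).memLp (hv.mem_right t ht).memLp, one_smul, one_smul,
    energyDist]

lemma IsMildSolution.exists_approximation (ha : IsCoefficient a) {u ut : ℝ → ℝ → ℝ}
    (hu : IsMildSolution a u ut) : ∃ v vt : ℕ → ℝ → ℝ → ℝ,
      (∀ n, IsClassicalSolution a (v n) (vt n)) ∧ ∀ t, 0 ≤ t →
        Tendsto (fun n => toL2 (weightedDeriv a (v n t))) atTop (𝓝 (toL2 (weightedDeriv a (u t)))) ∧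
        Tendsto (fun n => toL2 (vt n t)) atTop (𝓝 (toL2 (ut t))) := by
  have hex : ∀ n : ℕ, ∃ v vt : ℝ → ℝ → ℝ, IsClassicalSolution a v vt ∧ ∀ t, 0 ≤ t →
      toL2 (weightedDeriv a (v t)) =
        timeAverage (fun s => toL2 (weightedDeriv a (u s))) (1 / ((n : ℝ) + 1)) t ∧
      toL2 (vt t) = timeAverage (fun s => toL2 (ut s)) (1 / ((n : ℝ) + 1)) t := fun n =>
    hu.exists_average ha (by positivity)
  choose v vt hv hvt using hex
  have hlim : Tendsto (fun n : ℕ => 1 / ((n : ℝ) + 1)) atTop (𝓝[>] 0) :=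
    tendsto_nhdsWithin_iff.2 ⟨tendsto_one_div_add_atTop_nhds_zero_nat,
      Eventually.of_forall fun n => by simp only [mem_Ioi]; positivity⟩
  refine ⟨v, vt, hv, fun t ht => ⟨?_, ?_⟩⟩
  · exact ((tendsto_timeAverage hu.continuousOn_ux ht).comp hlim).congr
      fun n => ((hvt n t ht).1).symm
  · exact ((tendsto_timeAverage hu.continuousOn_ut ht).comp hlim).congr
      fun n => ((hvt n t ht).2).symm

lemma IsMildSolution.energy_conservation (ha : IsCoefficient a) {u ut : ℝ → ℝ → ℝ}
    (hu : IsMildSolution a u ut) {t : ℝ} (ht : 0 ≤ t) :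
    ‖toL2 (weightedDeriv a (u t))‖ ^ 2 + ‖toL2 (ut t)‖ ^ 2 =
      ‖toL2 (weightedDeriv a (u 0))‖ ^ 2 + ‖toL2 (ut 0)‖ ^ 2 := by
  obtain ⟨v, vt, hv, hlim⟩ := hu.exists_approximation ha
  have h1 := ((hlim t ht).1.norm.pow 2).add ((hlim t ht).2.norm.pow 2)
  have h0 := ((hlim 0 le_rfl).1.norm.pow 2).add ((hlim 0 le_rfl).2.norm.pow 2)
  exact tendsto_nhds_unique (h1.congr fun n => (hv n).energy_conservation ha ht) h0

/-- The difference of `w` and a classical average of `u` is classical, so its energy is conserved;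
then pass to the limit in the averages. -/
lemma IsMildSolution.energyDist_eq (ha : IsCoefficient a) {u ut w wt : ℝ → ℝ → ℝ}
    (hu : IsMildSolution a u ut) (hw : IsClassicalSolution a w wt) {t : ℝ} (ht : 0 ≤ t) :
    energyDist a w wt u ut t = energyDist a w wt u ut 0 := by
  obtain ⟨v, vt, hv, hlim⟩ := hu.exists_approximation ha
  have h : ∀ s, 0 ≤ s → Tendsto (fun n => energyDist a w wt (v n) (vt n) s) atTop
      (𝓝 (energyDist a w wt u ut s)) := fun s hs =>
    (((hlim s hs).1.const_sub _).norm.pow 2).add (((hlim s hs).2.const_sub _).norm.pow 2)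
  refine tendsto_nhds_unique ((h t ht).congr fun n => ?_) (h 0 le_rfl)
  rw [← hw.energyDist_sub (hv n) ht, ← hw.energyDist_sub (hv n) le_rfl]
  exact (hw.smul_sub ha 1 (hv n)).energy_conservation ha ht

/-- Convergence is assumed only at time `0`; constancy of the distance in time carries it to every
`t`. -/
lemma IsClassicalApproximation.tendsto (ha : IsCoefficient a) {u ut : ℝ → ℝ → ℝ}
    {un utn : ℕ → ℝ → ℝ → ℝ} (h : IsClassicalApproximation a un utn u ut)
    (hu : IsMildSolution a u ut) {t : ℝ} (ht : 0 ≤ t) :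
    Tendsto (fun n => toL2 (weightedDeriv a (un n t))) atTop (𝓝 (toL2 (weightedDeriv a (u t)))) ∧
      Tendsto (fun n => toL2 (utn n t)) atTop (𝓝 (toL2 (ut t))) := by
  have h0 := tendsto_energyDist h.tendsto_ux h.tendsto_ut
  have ht' : Tendsto (fun n => √(energyDist a (un n) (utn n) u ut t)) atTop (𝓝 0) := by
    have := (h0.congr fun n => (hu.energyDist_eq ha (h.classical n) ht).symm).sqrt
    rwa [Real.sqrt_zero] at this
  constructor
  · refine tendsto_iff_norm_sub_tendsto_zero.2 (squeeze_zero (fun _ => norm_nonneg _) (fun n => ?_) ht')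
    exact Real.le_sqrt_of_sq_le (le_add_of_nonneg_right (sq_nonneg _))
  · refine tendsto_iff_norm_sub_tendsto_zero.2 (squeeze_zero (fun _ => norm_nonneg _) (fun n => ?_) ht')
    exact Real.le_sqrt_of_sq_le (le_add_of_nonneg_left (sq_nonneg _))

/-! ### The normal derivative -/

lemma eLpNorm_two_eq_ofReal_sqrt {α : Type*} [MeasurableSpace α] {μ : Measure α} {f : α → ℝ}
    (hf : MemLp f 2 μ) : eLpNorm f 2 μ = ENNReal.ofReal √(∫ x, f x ^ 2 ∂μ) := by
  rw [hf.eLpNorm_eq_integral_rpow_norm (by norm_num) (by norm_num), Real.sqrt_eq_rpow]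
  simp

lemma intervalIntegral_eq_setIntegral_Ioo {T : ℝ} (hT : 0 ≤ T) (f : ℝ → ℝ) :
    ∫ t in (0 : ℝ)..T, f t = ∫ t in Ioo 0 T, f t := by
  rw [intervalIntegral.integral_of_le hT, integral_Ioc_eq_integral_Ioo]

/-- Convergence in `L²` implies convergence of the integrals of the squares. -/
lemma tendsto_integral_sq_of_eLpNorm {α : Type*} [MeasurableSpace α] {μ : Measure α}
    {f : ℕ → α → ℝ} {g : α → ℝ} (hf : ∀ n, MemLp (f n) 2 μ) (hg : MemLp g 2 μ)
    (h : Tendsto (fun n => eLpNorm (f n - g) 2 μ) atTop (𝓝 0)) :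
    Tendsto (fun n => ∫ x, f n x ^ 2 ∂μ) atTop (𝓝 (∫ x, g x ^ 2 ∂μ)) := by
  have hsq : ∀ {k : α → ℝ} (hk : MemLp k 2 μ), ‖hk.toLp k‖ ^ 2 = ∫ x, k x ^ 2 ∂μ := by
    intro k hk
    rw [Lp.norm_toLp, eLpNorm_two_eq_ofReal_sqrt hk, ENNReal.toReal_ofReal (Real.sqrt_nonneg _),
      Real.sq_sqrt (integral_nonneg fun x => sq_nonneg _)]
  have := (((Lp.tendsto_Lp_iff_tendsto_eLpNorm'' f hf g hg).2 h).norm).pow 2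
  rw [hsq hg] at this
  exact this.congr fun n => hsq (hf n)

/-- The constant in the estimate of the normal derivative by the energy of the initial data. -/
def traceConst (a : ℝ → ℝ) (T : ℝ) : ℝ := (3 * T + 2 / √(a 1)) / a 1

lemma IsClassicalSolution.memLp_trace (ha : IsCoefficient a) {u ut : ℝ → ℝ → ℝ}
    (hu : IsClassicalSolution a u ut) (T : ℝ) :
    MemLp (fun t => derivWithin (u t) (Icc 0 1) 1) 2 (volume.restrict (Ioo 0 T)) := by
  have hc := hu.continuousOn_trace ha
  obtain ⟨C, hC⟩ := isCompact_Icc.exists_bound_of_continuousOn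
    (hc.mono (Icc_subset_Ici_self : Icc 0 T ⊆ Ici 0))
  refine MemLp.of_bound ((hc.mono (Ioo_subset_Icc_self.trans Icc_subset_Ici_self)).aestronglyMeasurable
    measurableSet_Ioo) C ?_
  filter_upwards [ae_restrict_mem measurableSet_Ioo] with t ht
  exact hC t (Ioo_subset_Icc_self ht)

lemma IsClassicalSolution.eLpNorm_trace_sub_le (ha : IsCoefficient a) {u ut v vt : ℝ → ℝ → ℝ}
    (hu : IsClassicalSolution a u ut) (hv : IsClassicalSolution a v vt) {T : ℝ} (hT : 0 ≤ T) :
    eLpNorm (fun t => derivWithin (u t) (Icc 0 1) 1 - derivWithin (v t) (Icc 0 1) 1) 2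
        (volume.restrict (Ioo 0 T)) ≤
      ENNReal.ofReal √(traceConst a T * energyDist a u ut v vt 0) := by
  rw [eLpNorm_two_eq_ofReal_sqrt (f := fun t => derivWithin (u t) (Icc 0 1) 1 -
    derivWithin (v t) (Icc 0 1) 1) ((hu.memLp_trace ha T).sub (hv.memLp_trace ha T))]
  refine ENNReal.ofReal_le_ofReal (Real.sqrt_le_sqrt ?_)
  have h := (hu.smul_sub ha 1 hv).integral_trace_sq_le ha hT
  rw [hu.energyDist_sub hv le_rfl, mul_comm (a 1), ← le_div_iff₀ ha.pos_one,
    intervalIntegral_eq_setIntegral_Ioo hT, mul_div_right_comm] at h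
  refine le_trans (le_of_eq ?_) h
  refine setIntegral_congr_fun measurableSet_Ioo fun t ht => ?_
  rw [(hu.mem_left t ht.1.le).1.derivWithin_one_smul_sub ha 1 (hv.mem_left t ht.1.le).1, one_mul]

lemma norm_sub_sq_le {E : Type*} [SeminormedAddCommGroup E] (x y z : E) :
    ‖x - y‖ ^ 2 ≤ 2 * (‖x - z‖ ^ 2 + ‖y - z‖ ^ 2) := by
  have h := norm_sub_le (x - z) (y - z)
  rw [sub_sub_sub_cancel_right] at h
  nlinarith [norm_nonneg (x - y), sq_nonneg (‖x - z‖ - ‖y - z‖)]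

lemma energyDist_le (u ut v vt w wt : ℝ → ℝ → ℝ) (t : ℝ) :
    energyDist a u ut v vt t ≤ 2 * (energyDist a u ut w wt t + energyDist a v vt w wt t) := by
  have h1 := norm_sub_sq_le (toL2 (weightedDeriv a (u t))) (toL2 (weightedDeriv a (v t)))
    (toL2 (weightedDeriv a (w t)))
  have h2 := norm_sub_sq_le (toL2 (ut t)) (toL2 (vt t)) (toL2 (wt t))
  simp only [energyDist]
  linarith

lemma traceConst_nonneg (ha : IsCoefficient a) {T : ℝ} (hT : 0 ≤ T) : 0 ≤ traceConst a T := by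
  have := ha.pos_one
  unfold traceConst
  positivity

/-- A single `γ` has to serve every `T`. A rapidly convergent choice of approximants has traces
converging almost everywhere on `(0,∞)` as well as in each `L²(0,T)`; any other approximating
sequence is compared with it through the trace estimate. -/
lemma IsMildSolution.exists_isNormalDerivative (ha : IsCoefficient a) {u ut : ℝ → ℝ → ℝ}
    (hu : IsMildSolution a u ut) : ∃ γ : ℝ → ℝ, IsNormalDerivative a u ut γ := by
  obtain ⟨w, wt, hw, hlim⟩ := hu.exists_approximation ha
  have hd := tendsto_energyDist (hlim 0 le_rfl).1 (hlim 0 le_rfl).2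
  -- Squared distances below `4⁻ⁿ` make the norms summable.
  have hex : ∀ n : ℕ, ∃ v vt : ℝ → ℝ → ℝ, IsClassicalSolution a v vt ∧
      energyDist a v vt u ut 0 < (1 / 4 : ℝ) ^ n := fun n => by
    obtain ⟨N, hN⟩ := (hd.eventually (gt_mem_nhds (by positivity : (0 : ℝ) < (1 / 4) ^ n))).exists
    exact ⟨w N, wt N, hw N, hN⟩
  choose v vt hv hvd using hex
  set f : ℕ → ℝ → ℝ := fun n t => derivWithin (v n t) (Icc 0 1) 1
  have hfm : ∀ n, AEStronglyMeasurable (f n) (volume.restrict (Ioi 0)) := fun n =>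
    (((hv n).continuousOn_trace ha).mono Ioi_subset_Ici_self).aestronglyMeasurable measurableSet_Ioi
  set B : ℝ → ℕ → ENNReal := fun T N =>
    -- For `n, m ≥ N` the squared distance is at most `2 (4⁻ᴺ + 4⁻ᴺ) = (2 · 2⁻ᴺ)²`; the extra `1`
    -- makes the Cauchy bound strict.
    ENNReal.ofReal ((2 * √(traceConst a T) + 1) * (1 / 2) ^ N)
  have hB : ∀ T, ∑' N, B T N ≠ ⊤ := fun T =>
    (((summable_geometric_of_lt_one (by norm_num) (by norm_num)).mul_left
      (2 * √(traceConst a T) + 1)).tsum_ofReal_lt_top).ne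
  have hcau : ∀ T, 0 ≤ T → ∀ N n m : ℕ, N ≤ n → N ≤ m →
      eLpNorm (f n - f m) 2 (volume.restrict (Ioo 0 T)) < B T N := by
    intro T hT N n m hn hm
    refine ((hv n).eLpNorm_trace_sub_le ha (hv m) hT).trans_lt ?_
    refine (ENNReal.ofReal_lt_ofReal_iff (by positivity)).2 ?_
    have hpow : ∀ k, N ≤ k → (1 / 4 : ℝ) ^ k ≤ (1 / 4) ^ N := fun k hk =>
      pow_le_pow_of_le_one (by norm_num) (by norm_num) hk
    have h1 : energyDist a (v n) (vt n) (v m) (vt m) 0 ≤ (2 * (1 / 2 : ℝ) ^ N) ^ 2 := by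
      have h2 : (2 * (1 / 2 : ℝ) ^ N) ^ 2 = 4 * (1 / 4) ^ N := by
        rw [mul_pow, ← pow_mul, mul_comm N 2, pow_mul]
        norm_num
      rw [h2]
      have := energyDist_le (a := a) (v n) (vt n) (v m) (vt m) u ut 0
      linarith [hvd n, hvd m, hpow n hn, hpow m hm]
    have h3 : √(traceConst a T * energyDist a (v n) (vt n) (v m) (vt m) 0) ≤
        √(traceConst a T) * (2 * (1 / 2) ^ N) := by
      rw [Real.sqrt_mul (traceConst_nonneg ha hT)]
      gcongr
      exact (Real.sqrt_le_sqrt h1).trans_eq (Real.sqrt_sq (by positivity))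
    have h4 : (0 : ℝ) < (1 / 2) ^ N := by positivity
    linarith
  have hae : ∀ᵐ t ∂volume.restrict (Ioi 0), ∃ l, Tendsto (fun n => f n t) atTop (𝓝 l) := by
    have hU : Ioi (0 : ℝ) = ⋃ k : ℕ, Ioo (0 : ℝ) k := by
      ext t
      simp only [mem_Ioi, mem_iUnion, mem_Ioo]
      exact ⟨fun ht => (exists_nat_gt t).imp fun k hk => ⟨ht, hk⟩, fun ⟨k, hk⟩ => hk.1⟩
    rw [hU, ae_restrict_iUnion_iff]
    exact fun k => Lp.ae_tendsto_of_cauchy_eLpNorm (p := 2)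
      (fun n => (hfm n).mono_measure (Measure.restrict_mono_set _ Ioo_subset_Ioi_self)) (by norm_num)
      (hB k) (hcau k k.cast_nonneg)
  obtain ⟨γ, hγ, hγlim⟩ := exists_stronglyMeasurable_limit_of_tendsto_ae hfm hae
  refine ⟨γ, hγ.aestronglyMeasurable,
    ⟨w, wt, hw, (hlim 0 le_rfl).1, (hlim 0 le_rfl).2⟩, fun un utn hun T hT => ?_⟩
  have hμ : volume.restrict (Ioo 0 T) ≤ volume.restrict (Ioi 0) :=
    Measure.restrict_mono_set _ Ioo_subset_Ioi_self
  have hfγ : Tendsto (fun n => eLpNorm (f n - γ) 2 (volume.restrict (Ioo 0 T))) atTop (𝓝 0) :=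
    Lp.cauchy_tendsto_of_tendsto (fun n => (hfm n).mono_measure hμ) γ (hB T) (hcau T hT)
      (ae_mono hμ hγlim)
  have hvd0 : Tendsto (fun n => energyDist a (v n) (vt n) u ut 0) atTop (𝓝 0) :=
    squeeze_zero (fun n => by unfold energyDist; positivity) (fun n => (hvd n).le)
      (tendsto_pow_atTop_nhds_zero_of_lt_one (by norm_num) (by norm_num))
  have hdist : Tendsto (fun n => ENNReal.ofReal √(traceConst a T * (2 *
      (energyDist a (un n) (utn n) u ut 0 + energyDist a (v n) (vt n) u ut 0)))) atTop (𝓝 0) := by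
    have := ENNReal.tendsto_ofReal ((((tendsto_energyDist hun.tendsto_ux hun.tendsto_ut).add
      hvd0).const_mul 2).const_mul (traceConst a T)).sqrt
    simpa only [add_zero, mul_zero, Real.sqrt_zero, ENNReal.ofReal_zero] using this
  have hsum := hdist.add hfγ
  rw [add_zero] at hsum
  refine tendsto_of_tendsto_of_tendsto_of_le_of_le tendsto_const_nhds hsum (fun _ => zero_le) ?_
  intro n
  have hsplit : (fun t => derivWithin (un n t) (Icc 0 1) 1 - γ t) =
      (fun t => derivWithin (un n t) (Icc 0 1) 1 - f n t) + (f n - γ) := by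
    ext t
    simp only [Pi.add_apply, Pi.sub_apply]
    ring
  have hfn : MemLp (f n) 2 (volume.restrict (Ioo 0 T)) := (hv n).memLp_trace ha T
  simp only
  rw [hsplit]
  refine (eLpNorm_add_le (((hun.classical n).memLp_trace ha T).1.sub hfn.1)
    (hfn.1.sub (hγ.aestronglyMeasurable)) (by norm_num)).trans ?_
  gcongr
  refine ((hun.classical n).eLpNorm_trace_sub_le ha (hv n) hT).trans ?_
  have := traceConst_nonneg ha hT
  gcongr
  exact energyDist_le _ _ _ _ _ _ _

/-- The multiplier identity for the normal derivative of a mild solution. -/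
lemma IsNormalDerivative.memLp_and_identity (ha : IsCoefficient a) {u ut : ℝ → ℝ → ℝ} {γ : ℝ → ℝ}
    (hγ : IsNormalDerivative a u ut γ) (hu : IsMildSolution a u ut) {T : ℝ} (hT : 0 ≤ T) :
    MemLp γ 2 (volume.restrict (Ioo 0 T)) ∧
    a 1 * (∫ t in (0 : ℝ)..T, γ t ^ 2) =
      (∫ t in (0 : ℝ)..T, bulkForm ha (toL2 (weightedDeriv a (u t))) (toL2 (ut t))) +
        2 * (crossForm ha (toL2 (weightedDeriv a (u T))) (toL2 (ut T)) -
          crossForm ha (toL2 (weightedDeriv a (u 0))) (toL2 (ut 0))) := by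
  obtain ⟨un, utn, hun⟩ := hγ.exists_approximation
  have hlim := hγ.tendsto un utn hun T hT
  have hμ : volume.restrict (Ioo 0 T) ≤ volume.restrict (Ioi 0) :=
    Measure.restrict_mono_set _ Ioo_subset_Ioi_self
  have hmem : ∀ n, MemLp (fun t => derivWithin (un n t) (Icc 0 1) 1) 2 (volume.restrict (Ioo 0 T)) :=
    fun n => (hun.classical n).memLp_trace ha T
  have hγm := hγ.aestronglyMeasurable.mono_measure hμ
  have hγmem : MemLp γ 2 (volume.restrict (Ioo 0 T)) :=
    Lp.memLp_of_cauchy_tendsto (by norm_num) hmem γ hγm hlim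
  refine ⟨hγmem, ?_⟩
  have hL := (tendsto_integral_sq_of_eLpNorm hmem hγmem hlim).const_mul (a 1)
  rw [← intervalIntegral_eq_setIntegral_Ioo hT] at hL
  have hE : Tendsto (fun n => ‖toL2 (weightedDeriv a (un n 0))‖ ^ 2 + ‖toL2 (utn n 0)‖ ^ 2) atTop
      (𝓝 (‖toL2 (weightedDeriv a (u 0))‖ ^ 2 + ‖toL2 (ut 0)‖ ^ 2)) :=
    (hun.tendsto_ux.norm.pow 2).add (hun.tendsto_ut.norm.pow 2)
  set S := ‖toL2 (weightedDeriv a (u 0))‖ ^ 2 + ‖toL2 (ut 0)‖ ^ 2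
  have hbulk : Tendsto (fun n => ∫ t in (0 : ℝ)..T,
      bulkForm ha (toL2 (weightedDeriv a (un n t))) (toL2 (utn n t))) atTop
      (𝓝 (∫ t in (0 : ℝ)..T, bulkForm ha (toL2 (weightedDeriv a (u t))) (toL2 (ut t)))) := by
    -- The initial energies converge, so they are eventually below `S + 1`; conservation makes this
    -- bound uniform in time.
    refine intervalIntegral.tendsto_integral_filter_of_dominated_convergence
      (fun _ => 3 * (S + 1)) (Eventually.of_forall fun n => ?_) ?_ intervalIntegrable_const ?_
    · refine (((hun.classical n).continuousOn_bulkForm ha).mono ?_).aestronglyMeasurable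
        measurableSet_uIoc
      rw [uIoc_of_le hT]
      exact fun t ht => ht.1.le
    · filter_upwards [hE.eventually (gt_mem_nhds (lt_add_one S))] with n hn
      refine Eventually.of_forall fun t ht => ?_
      rw [uIoc_of_le hT] at ht
      refine (abs_bulkForm_le ha _ _).trans ?_
      rw [(hun.classical n).energy_conservation ha ht.1.le]
      linarith
    · refine Eventually.of_forall fun t ht => ?_
      rw [uIoc_of_le hT] at ht
      exact tendsto_bulkForm ha (hun.tendsto ha hu ht.1.le).1 (hun.tendsto ha hu ht.1.le).2
  have hR := hbulk.add (((tendsto_crossForm ha (hun.tendsto ha hu hT).1 (hun.tendsto ha hu hT).2).sub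
    (tendsto_crossForm ha hun.tendsto_ux hun.tendsto_ut)).const_mul 2)
  refine tendsto_nhds_unique hL (hR.congr fun n => ?_)
  rw [← intervalIntegral_eq_setIntegral_Ioo hT]
  exact ((hun.classical n).multiplier_identity ha hT).symm

/-! ### The forms in terms of the solution -/

lemma sq_weightedDeriv (ha : IsCoefficient a) (w : ℝ → ℝ) {x : ℝ} (hx : x ∈ Ioo (0 : ℝ) 1) :
    weightedDeriv a w x ^ 2 = a x * deriv w x ^ 2 := by
  rw [weightedDeriv, mul_pow, Real.sq_sqrt (ha.pos_Ioo hx).le]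

lemma energy_eq (ha : IsCoefficient a) {u ut : ℝ → ℝ → ℝ} (hu : IsMildSolution a u ut) {t : ℝ}
    (ht : 0 ≤ t) :
    2 * energy a u ut t = ‖toL2 (weightedDeriv a (u t))‖ ^ 2 + ‖toL2 (ut t)‖ ^ 2 := by
  have hx := (hu.mem_left t ht).memLp_weightedDeriv
  have ht' := hu.mem_right t ht
  rw [energy, intervalIntegral_eq_integral_unitMeasure, norm_sq_toL2 hx, norm_sq_toL2 ht',
    ← integral_add hx.integrable_sq ht'.integrable_sq, ← mul_assoc]
  norm_num
  refine integral_congr_ae ?_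
  filter_upwards [ae_restrict_mem measurableSet_Ioo] with x hx'
  rw [sq_weightedDeriv ha _ hx', add_comm]

lemma bulkForm_eq (ha : IsCoefficient a) {f v : ℝ → ℝ} (hf : MemV1 a f)
    (hv : MemLp v 2 unitMeasure) :
    bulkForm ha (toL2 (weightedDeriv a f)) (toL2 v) =
      ∫ x in (0 : ℝ)..1, (v x ^ 2 + (a x - x * coeffDeriv a x) * deriv f x ^ 2) := by
  have hN := hf.memLp_defect ha
  have hi : Integrable (fun x => (1 - x * coeffDeriv a x / a x) * weightedDeriv a f x *
      weightedDeriv a f x) unitMeasure :=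
    MemLp.integrable_mul (p := 2) (q := 2) hN hf.memLp_weightedDeriv
  rw [bulkForm, norm_sq_toL2 hv, ha.defectMul_toL2 hf.memLp_weightedDeriv,
    inner_toL2 hN hf.memLp_weightedDeriv, ← integral_add hv.integrable_sq hi,
    intervalIntegral_eq_integral_unitMeasure]
  refine integral_congr_ae ?_
  filter_upwards [ae_restrict_mem measurableSet_Ioo] with x hx
  have hax := (ha.pos_Ioo hx).ne'
  rw [mul_assoc, ← sq, sq_weightedDeriv ha _ hx]
  field_simp

lemma crossForm_eq (ha : IsCoefficient a) {f v : ℝ → ℝ} (hf : MemV1 a f)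
    (hv : MemLp v 2 unitMeasure) :
    crossForm ha (toL2 (weightedDeriv a f)) (toL2 v) = ∫ x in (0 : ℝ)..1, x * deriv f x * v x := by
  obtain ⟨hm, heq⟩ := hf.memLp_id_mul_deriv ha
  rw [crossForm, heq, inner_toL2 hm hv, intervalIntegral_eq_integral_unitMeasure]

/-- The multiplier bound produces `1/√a(1)`; this passes to the coarser constant of the theorem. -/
lemma one_div_sqrt_le (ha : IsCoefficient a) : 1 / √(a 1) ≤ 1 / min 1 (a 1) := by
  have h1 := ha.pos_one
  refine one_div_le_one_div_of_le (lt_min one_pos h1) ?_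
  refine Real.le_sqrt_of_sq_le ?_
  rcases le_total 1 (a 1) with h | h
  · rw [min_eq_left h]
    linarith
  · rw [min_eq_right h]
    nlinarith

lemma IsNormalDerivative.integral_sq_le (ha : IsCoefficient a) {u ut : ℝ → ℝ → ℝ} {γ : ℝ → ℝ}
    (hγ : IsNormalDerivative a u ut γ) (hu : IsMildSolution a u ut) {T : ℝ} (hT : 0 ≤ T) :
    a 1 * (∫ t in (0 : ℝ)..T, γ t ^ 2) ≤ (6 * T + 4 / min 1 (a 1)) * energy a u ut 0 := by
  have hE := energy_eq ha hu le_rfl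
  rw [(hγ.memLp_and_identity ha hu hT).2]
  have h1 : ‖∫ t in (0 : ℝ)..T, bulkForm ha (toL2 (weightedDeriv a (u t))) (toL2 (ut t))‖ ≤
      3 * (2 * energy a u ut 0) * |T - 0| := by
    refine intervalIntegral.norm_integral_le_of_norm_le_const fun t ht => ?_
    rw [uIoc_of_le hT] at ht
    rw [hE, ← hu.energy_conservation ha ht.1.le]
    exact abs_bulkForm_le ha _ _
  rw [sub_zero, abs_of_nonneg hT] at h1
  have h2 := two_mul_abs_crossForm_le ha (toL2 (weightedDeriv a (u T))) (toL2 (ut T))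
  have h3 := two_mul_abs_crossForm_le ha (toL2 (weightedDeriv a (u 0))) (toL2 (ut 0))
  rw [hu.energy_conservation ha hT] at h2
  rw [← hE] at h2 h3
  have h4 := le_abs_self (crossForm ha (toL2 (weightedDeriv a (u T))) (toL2 (ut T)))
  have h5 := neg_abs_le (crossForm ha (toL2 (weightedDeriv a (u 0))) (toL2 (ut 0)))
  have h6 := (le_abs_self _).trans h1
  have h7 : 0 ≤ 2 * energy a u ut 0 := by
    rw [hE]
    positivity
  have h8 := mul_le_mul_of_nonneg_right (one_div_sqrt_le ha) h7
  -- The bulk form contributes `3 · 2E` per unit of time, and the cross form `2E / min 1 (a 1)` at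
  -- each of the two endpoints.
  have h9 : (6 * T + 4 / min 1 (a 1)) * energy a u ut 0 =
      3 * (2 * energy a u ut 0) * T + 2 * (1 / min 1 (a 1) * (2 * energy a u ut 0)) := by ring
  rw [h9]
  linarith

end DegenerateWave

end

theorem mainTheorem2 (a : ℝ → ℝ) (ha : DegenerateWave.IsCoefficient a)
    (u ut : ℝ → ℝ → ℝ) (hu : DegenerateWave.IsMildSolution a u ut) :
    (∃ γ : ℝ → ℝ, DegenerateWave.IsNormalDerivative a u ut γ) ∧
    ∀ γ : ℝ → ℝ, DegenerateWave.IsNormalDerivative a u ut γ → ∀ T : ℝ, 0 ≤ T →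
      MemLp γ 2 (volume.restrict (Ioo 0 T)) ∧
      a 1 * (∫ t in (0 : ℝ)..T, γ t ^ 2) ≤
        (6 * T + 4 / min 1 (a 1)) * DegenerateWave.energy a u ut 0 ∧
      a 1 * (∫ t in (0 : ℝ)..T, γ t ^ 2) =
        (∫ t in (0 : ℝ)..T, ∫ x in (0 : ℝ)..1,
          (ut t x ^ 2 + (a x - x * DegenerateWave.coeffDeriv a x) * deriv (u t) x ^ 2)) +
        2 * ((∫ x in (0 : ℝ)..1, x * deriv (u T) x * ut T x) -
          ∫ x in (0 : ℝ)..1, x * deriv (u 0) x * ut 0 x) := by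
  refine ⟨hu.exists_isNormalDerivative ha, fun γ hγ T hT => ?_⟩
  obtain ⟨hmem, hid⟩ := hγ.memLp_and_identity ha hu hT
  refine ⟨hmem, hγ.integral_sq_le ha hu hT, ?_⟩
  have hT0 : (0 : ℝ) ≤ 0 := le_rfl
  rw [hid, DegenerateWave.crossForm_eq ha (hu.mem_left T hT).toMemV1 (hu.mem_right T hT),
    DegenerateWave.crossForm_eq ha (hu.mem_left 0 hT0).toMemV1 (hu.mem_right 0 hT0)]
  congr 1
  refine intervalIntegral.integral_congr fun t ht => ?_
  rw [uIcc_of_le hT] at ht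
  exact DegenerateWave.bulkForm_eq ha (hu.mem_left t ht.1).toMemV1 (hu.mem_right t ht.1)
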